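/- Let $dg$ be the Haar probability measure on $\mathrm{SU}(2)$, let $\mathrm{st}$ be the standard representation of $\mathrm{SU}(2)$ on $\mathbb{C}^2$, let $\mathrm{sym}^m$ be its $m$-th symmetric power, and let $\chi_{\mathrm{sym}^m}$ be the character of $\mathrm{sym}^m$. For a representation $\rho$ of $\mathrm{SU}(2)$, put $D(X,\rho,g)=\det[I-X\rho(g)]^{-1}$. For $z\in\mathbb{C}$ define $$L^{1,z}\left(\tfrac12,1;\mathrm{st},\mathrm{sym}^m\right)=\prod_{p}\int_{\mathrm{SU}(2)}D(p^{-1/2},\mathrm{st},g)\,D(p^{-1},\mathrm{sym}^m,g)^z\,dg,$$ $$L^{1,z}\left(1,1;\mathrm{sym}^2,\mathrm{sym}^m\right)=\prod_{p}\int_{\mathrm{SU}(2)}D(p^{-1},\mathrm{sym}^2,g)\,D(p^{-1},\mathrm{sym}^m,g)^z\,dg,$$ where $p$ runs over all primes. Let $\gamma^*=\lim_{x\to+\infty}\bigl(\sum_{p\le x}\frac1p-\log\log x\bigr)$; this constant satisfies $$\sum_{p\le x}\frac1p=\log\log x+\gamma^*+O\left(\frac1{\log x}\right)\qquad(x\ge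 2).$$ For either choice of sign define $$\mathrm{sym}^m_{\pm}=\max_{g\in\mathrm{SU}(2)}\pm\chi_{\mathrm{sym}^m}(g),$$ $$\mathrm{sym}^{m,1}_{\pm}=\gamma^*\,\mathrm{sym}^m_{\pm}+\sum_{p}\left\{\pm\log\left(\pm\max_{g\in\mathrm{SU}(2)}\pm D(p^{-1},\mathrm{sym}^m,g)\right)-\frac{\mathrm{sym}^m_{\pm}}{p}\right\}.$$ Proposition. Let $m\in\{1,2,4\}$. The series defining $\mathrm{sym}^{m,1}_{\pm}$ converge absolutely. For every real $z$, both Euler products above converge (unconditionally) to positive real numbers. As $r\to+\infty$ in $\mathbb{R}$, for either choice of sign, $$\log L^{1,\pm r}\left(\tfrac12,1;\mathrm{st},\mathrm{sym}^m\right)=\mathrm{sym}^m_{\pm}\,r\log\log r+\mathrm{sym}^{m,1}_{\pm}\,r+O_m\left(\frac{r}{\log r}\right)$$ and $$\log L^{1,\pm r}\left(1,1;\mathrm{sym}^2,\mathrm{sym}^m\right)=\mathrm{sym}^m_{\pm}\,r\log\log r+\mathrm{sym}^{m,1}_{\pm}\,r+O_m\left(\frac{r}{\log r}\right).$$ -/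

import Mathlib

open MeasureTheory Filter Topology Asymptotics

noncomputable section

namespace SymPow

/-! ### The compact group `SU(2)` and its normalised Haar measure -/

/-- The group `SU(2)`. -/
abbrev SU2 : Type := Matrix.specialUnitaryGroup (Fin 2) ℂ

instance instContinuousMulSU2 : ContinuousMul SU2 where
  continuous_mul :=
    ((continuous_subtype_val.comp continuous_fst).matrix_mul
      (continuous_subtype_val.comp continuous_snd)).subtype_mk _

instance instContinuousInvSU2 : ContinuousInv SU2 where
  continuous_inv := (continuous_subtype_val.matrix_conjTranspose).subtype_mk _

instance instIsTopologicalGroupSU2 : IsTopologicalGroup SU2 where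

instance instCompactSpaceSU2 : CompactSpace SU2 := by
  refine isCompact_iff_compactSpace.mp ?_
  have hsub : ((Matrix.specialUnitaryGroup (Fin 2) ℂ : Submonoid (Matrix (Fin 2) (Fin 2) ℂ)) :
      Set (Matrix (Fin 2) (Fin 2) ℂ)) ⊆
      Set.pi Set.univ fun _ : Fin 2 => Set.pi Set.univ fun _ : Fin 2 =>
        Metric.closedBall (0 : ℂ) 1 := by
    intro A hA i _ j _
    rw [mem_closedBall_zero_iff]
    exact entry_norm_bound_of_unitary (Matrix.specialUnitaryGroup_le_unitaryGroup hA) i j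
  refine IsCompact.of_isClosed_subset ?_ ?_ hsub
  · exact isCompact_univ_pi fun _ => isCompact_univ_pi fun _ => isCompact_closedBall _ _
  · have : ((Matrix.specialUnitaryGroup (Fin 2) ℂ : Submonoid (Matrix (Fin 2) (Fin 2) ℂ)) :
        Set (Matrix (Fin 2) (Fin 2) ℂ)) =
        {A | A * A.conjTranspose = 1} ∩ {A | A.det = 1} := by
      ext A
      simp only [SetLike.mem_coe, Matrix.mem_specialUnitaryGroup_iff, Matrix.mem_unitaryGroup_iff,
        Matrix.star_eq_conjTranspose, Set.mem_inter_iff, Set.mem_ofPred_eq]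
    rw [this]
    exact (isClosed_eq (continuous_id.matrix_mul continuous_id.matrix_conjTranspose)
      continuous_const).inter (isClosed_eq continuous_id.matrix_det continuous_const)

instance instMeasurableSpaceSU2 : MeasurableSpace SU2 := borel SU2

instance instBorelSpaceSU2 : BorelSpace SU2 := ⟨rfl⟩

/-- The Haar measure of `SU(2)`, normalised to have total mass `1`. -/
def haarSU2 : Measure SU2 := Measure.haarMeasure ⊤

/-! ### Symmetric powers -/

/-- The polynomial `(a + c X) ^ (m - j) * (b + d X) ^ j` attached to `A = !![a, b; c, d]`. It is the
image under `A` of the monomial `e₀ ^ (m - j) * e₁ ^ j` of the `m`-th symmetric power of `ℂ²`,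
dehomogenised by `e₀ = 1` and `e₁ = X`. -/
def symPoly (m : ℕ) (A : Matrix (Fin 2) (Fin 2) ℂ) (j : ℕ) : Polynomial ℂ :=
  (Polynomial.C (A 0 0) + Polynomial.C (A 1 0) * Polynomial.X) ^ (m - j) *
    (Polynomial.C (A 0 1) + Polynomial.C (A 1 1) * Polynomial.X) ^ j

/-- The matrix of the `m`-th symmetric power of `A`, in the basis `e₀ ^ (m - i) * e₁ ^ i`,
`0 ≤ i ≤ m`. -/
def symMatrix (m : ℕ) (A : Matrix (Fin 2) (Fin 2) ℂ) : Matrix (Fin (m + 1)) (Fin (m + 1)) ℂ :=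
  Matrix.of fun i j => (symPoly m A j).coeff i

lemma natDegree_linear_le (a c : ℂ) :
    (Polynomial.C a + Polynomial.C c * Polynomial.X).natDegree ≤ 1 := by
  rw [add_comm]
  exact Polynomial.natDegree_linear_le

lemma homogenize_linear_pow (a c : ℂ) (k : ℕ) :
    ((Polynomial.C a + Polynomial.C c * Polynomial.X) ^ k).homogenize k =
      (MvPolynomial.C a * MvPolynomial.X 1 + MvPolynomial.C c * MvPolynomial.X 0) ^ k := by
  induction k with
  | zero => simp
  | succ k ih =>
    rw [pow_succ, Polynomial.homogenize_mul, ih, pow_succ]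
    · simp
    · exact (Polynomial.natDegree_pow_le).trans
        ((Nat.mul_le_mul_left k (natDegree_linear_le a c)).trans (by simp))
    · exact natDegree_linear_le a c

/-- Substituting `u`, `v` for `e₀`, `e₁` in the image of a basis monomial. -/
lemma sum_symPoly (m : ℕ) (B : Matrix (Fin 2) (Fin 2) ℂ) {j : ℕ} (hj : j ≤ m)
    (u v : Polynomial ℂ) :
    ∑ k : Fin (m + 1), Polynomial.C ((symPoly m B j).coeff k) * (u ^ (m - (k : ℕ)) * v ^ (k : ℕ)) =
      (Polynomial.C (B 0 0) * u + Polynomial.C (B 1 0) * v) ^ (m - j) *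
        (Polynomial.C (B 0 1) * u + Polynomial.C (B 1 1) * v) ^ j := by
  have h1 : (symPoly m B j).homogenize m =
      (MvPolynomial.C (B 0 0) * MvPolynomial.X 1 + MvPolynomial.C (B 1 0) * MvPolynomial.X 0)
        ^ (m - j) *
      (MvPolynomial.C (B 0 1) * MvPolynomial.X 1 + MvPolynomial.C (B 1 1) * MvPolynomial.X 0)
        ^ j := by
    rw [← homogenize_linear_pow, ← homogenize_linear_pow]
    have hm : m = (m - j) + j := by omega
    conv_lhs => rw [hm]
    rw [← Polynomial.homogenize_mul]
    · simp only [symPoly, ← hm]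
    · exact (Polynomial.natDegree_pow_le).trans
        ((Nat.mul_le_mul_left _ (natDegree_linear_le _ _)).trans (by simp))
    · exact (Polynomial.natDegree_pow_le).trans
        ((Nat.mul_le_mul_left _ (natDegree_linear_le _ _)).trans (by simp))
  have h2 := congrArg (MvPolynomial.aeval ![v, u]) h1
  rw [Polynomial.homogenize, Finset.Nat.sum_antidiagonal_eq_sum_range_succ_mk] at h2
  rw [Finset.sum_range] at h2
  simp [MvPolynomial.aeval_monomial, Finsupp.update_eq_add_single, Finsupp.prod_add_index',
    pow_add] at h2
  rw [← h2]
  exact Finset.sum_congr rfl fun k _ => by ring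

lemma symMatrix_mul (m : ℕ) (A B : Matrix (Fin 2) (Fin 2) ℂ) :
    symMatrix m (A * B) = symMatrix m A * symMatrix m B := by
  ext i j
  have hj : (j : ℕ) ≤ m := Nat.lt_succ_iff.mp j.2
  have h := congrArg (fun P : Polynomial ℂ => P.coeff (i : ℕ))
    (sum_symPoly m B hj (Polynomial.C (A 0 0) + Polynomial.C (A 1 0) * Polynomial.X)
      (Polynomial.C (A 0 1) + Polynomial.C (A 1 1) * Polynomial.X))
  simp only [Polynomial.finsetSum_coeff, Polynomial.coeff_C_mul] at h
  simp only [symMatrix, Matrix.mul_apply, Matrix.of_apply]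
  have h3 : symPoly m (A * B) j =
      (Polynomial.C (B 0 0) * (Polynomial.C (A 0 0) + Polynomial.C (A 1 0) * Polynomial.X) +
        Polynomial.C (B 1 0) * (Polynomial.C (A 0 1) + Polynomial.C (A 1 1) * Polynomial.X))
          ^ (m - (j : ℕ)) *
      (Polynomial.C (B 0 1) * (Polynomial.C (A 0 0) + Polynomial.C (A 1 0) * Polynomial.X) +
        Polynomial.C (B 1 1) * (Polynomial.C (A 0 1) + Polynomial.C (A 1 1) * Polynomial.X))
          ^ (j : ℕ) := by
    simp only [symPoly, Matrix.mul_apply, Fin.sum_univ_two, Polynomial.C_add, Polynomial.C_mul]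
    congr 2 <;> ring
  rw [h3, ← h]
  exact Finset.sum_congr rfl fun k _ => by rw [mul_comm]; rfl

lemma symMatrix_one (m : ℕ) : symMatrix m 1 = 1 := by
  ext i j
  simp [symMatrix, symPoly, Polynomial.coeff_X_pow, Matrix.one_apply, Fin.ext_iff]

/-- The standard representation `st` of `SU(2)` on `ℂ²`. -/
def st : SU2 →* Matrix (Fin 2) (Fin 2) ℂ := (Matrix.specialUnitaryGroup (Fin 2) ℂ).subtype

/-- The representation `sym^m` of `SU(2)`: the `m`-th symmetric power of `st`. -/
def sym (m : ℕ) : SU2 →* Matrix (Fin (m + 1)) (Fin (m + 1)) ℂ where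
  toFun g := symMatrix m (st g)
  map_one' := by rw [map_one, symMatrix_one]
  map_mul' g h := by rw [map_mul, symMatrix_mul]

/-- The character `χ_ρ` of a representation `ρ` of `SU(2)`. -/
def character {n : ℕ} (ρ : SU2 →* Matrix (Fin n) (Fin n) ℂ) (g : SU2) : ℂ := (ρ g).trace

/-- `D(X, ρ, g) = det (I - X ρ(g))⁻¹`. -/
def eulerD {n : ℕ} (X : ℂ) (ρ : SU2 →* Matrix (Fin n) (Fin n) ℂ) (g : SU2) : ℂ :=
  ((1 - X • ρ g).det)⁻¹

/-! ### The Euler products -/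

/-- The local factor at `p`: the integral over `SU(2)` of
`D(p ^ (-s₁), ρ₁, g) * D(p ^ (-s₂), ρ₂, g) ^ z`. -/
def localFactor {n₁ n₂ : ℕ} (s₁ s₂ : ℂ) (ρ₁ : SU2 →* Matrix (Fin n₁) (Fin n₁) ℂ)
    (ρ₂ : SU2 →* Matrix (Fin n₂) (Fin n₂) ℂ) (z : ℂ) (p : Nat.Primes) : ℂ :=
  ∫ g : SU2, eulerD ((p : ℂ) ^ (-s₁)) ρ₁ g * eulerD ((p : ℂ) ^ (-s₂)) ρ₂ g ^ z ∂haarSU2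

/-- `L^{1,z}(s₁, s₂; ρ₁, ρ₂)`: the product of the local factors over all primes. -/
def twistedL {n₁ n₂ : ℕ} (s₁ s₂ : ℂ) (ρ₁ : SU2 →* Matrix (Fin n₁) (Fin n₁) ℂ)
    (ρ₂ : SU2 →* Matrix (Fin n₂) (Fin n₂) ℂ) (z : ℂ) : ℂ :=
  ∏' p : Nat.Primes, localFactor s₁ s₂ ρ₁ ρ₂ z p

/-! ### The constants -/

/-- The sum of `1 / p` over the primes `p ≤ x`. -/
def primeRecipSum (x : ℝ) : ℝ := ∑ p ∈ Finset.Icc 1 ⌊x⌋₊ with p.Prime, 1 / (p : ℝ)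

/-- The constant `γ*`: the limit of `∑_{p ≤ x} 1 / p - log log x` as `x → +∞`. -/
def gammaStar : ℝ := limUnder atTop fun x : ℝ => primeRecipSum x - Real.log (Real.log x)

/-- `sym^m_±`, the maximum over `g ∈ SU(2)` of `± χ_{sym^m}(g)`; the sign is `ε = ± 1`.
The character is real valued and continuous on a compact group, so the supremum is a maximum. -/
def symSup (m : ℕ) (ε : ℝ) : ℝ := ⨆ g : SU2, ε * (character (sym m) g).re

/-- The maximum over `g ∈ SU(2)` of `± D(p⁻¹, sym^m, g)`; the sign is `ε = ± 1`.
These values are real and continuous in `g`, so the supremum is a maximum. -/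
def eulerDSup (m : ℕ) (ε : ℝ) (p : Nat.Primes) : ℝ :=
  ⨆ g : SU2, ε * (eulerD ((p : ℂ)⁻¹) (sym m) g).re

/-- The summand `± log (± max (± D(p⁻¹, sym^m, g))) - sym^m_± / p`. -/
def symOneTerm (m : ℕ) (ε : ℝ) (p : Nat.Primes) : ℝ :=
  ε * Real.log (ε * eulerDSup m ε p) - symSup m ε / (p : ℝ)

/-- The constant `sym^{m,1}_±`. -/
def symOne (m : ℕ) (ε : ℝ) : ℝ := gammaStar * symSup m ε + ∑' p : Nat.Primes, symOneTerm m ε p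

/-- The main term `sym^m_± r log log r + sym^{m,1}_± r`. -/
def mainTerm (m : ℕ) (ε r : ℝ) : ℝ :=
  symSup m ε * r * Real.log (Real.log r) + symOne m ε * r

end SymPow

end

/-! All representations involved are seen through the trace `tr g` ∈ [-2, 2]. Write `l p g` = log
D(1/p, sym^m, g) and `w p g` for the first factor of the integrand. The local factor at real z is
then the positive number ∫ w exp(z l), and the logarithm of the product is the sum of the logarithms
of these integrals. With z = εr, ε = ±1, the primes are split at p = r.

For p > r the exponent z l is bounded, so the exponential can be expanded to first order. Since l =
χ/p + O(p⁻²) with ∫ χ = 0, w = 1 + O(p^(-1/2)) and ∫ w = 1 + O(p^(-3/2)), the logarithm of the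
integral is O((1 + r) p^(-3/2) + r² p⁻²) (`LocalData.exists_abs_log_localInt_le`). Chebyshev's bound
makes the total over p > r equal to O(r / log r).

For p ≤ r Laplace's method applies. Let M be the maximum of ε l over SU(2). The integral is at most
a constant times exp(rM). Since l is Lipschitz in the trace with constant O(1/p), it is also at
least a constant times exp(rM) times the Haar measure of the set where the trace is within p/r of
its value at a maximiser. That measure is ≫ (p/r)⁴, and only its logarithm matters, so the logarithm
of the integral is rM + O(1 + log(r/p)) (`LocalData.exists_abs_log_localInt_sub_le`). Chebyshev
again sums the errors to O(r / log r).

What remains is r times the sum of the maxima over p ≤ r. Each maximum is sym^m_± / p plus a term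
O(p⁻²), so Mertens' second theorem gives the r log log r term and the constant
(`SymData.exists_abs_sum_logDSup_sub_le`). For m = 1, 2, 4 the determinant is a product of factors 1
- X and 1 - sX + X² with s polynomial in the trace, and ∫ χ = 0 follows from the trace moments 0, 1,
2 of orders 1, 2, 4. -/

namespace SymPow

/-! ### Sums over primes -/

/-- The primes up to `n`. -/
def primesUpTo (n : ℕ) : Finset ℕ := (Finset.Icc 1 n).filter Nat.Prime

lemma mem_primesUpTo {n p : ℕ} : p ∈ primesUpTo n ↔ p ≤ n ∧ p.Prime := by
  simp only [primesUpTo, Finset.mem_filter, Finset.mem_Icc]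
  exact ⟨fun h => ⟨h.1.2, h.2⟩, fun h => ⟨⟨h.2.one_lt.le, h.1⟩, h.2⟩⟩

lemma theta_eq_sum_primesUpTo (n : ℕ) : Chebyshev.theta n = ∑ p ∈ primesUpTo n, Real.log p := by
  rw [Chebyshev.theta_eq_sum_Icc, Nat.floor_natCast]
  refine Finset.sum_congr ?_ fun _ _ => rfl
  ext p
  simp only [mem_primesUpTo, Finset.mem_filter, Finset.mem_Icc, Nat.zero_le, true_and]

/-! ### Mertens' first theorem, from the factorisation of n!. -/

lemma log_factorial_eq_sum (n : ℕ) :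
    Real.log (n.factorial : ℝ) = ∑ p ∈ primesUpTo n, (padicValNat p n.factorial : ℝ) * Real.log p := by
  rw [Real.log_nat_eq_sum_factorization, Finsupp.sum_of_support_subset (s := primesUpTo n)]
  · refine Finset.sum_congr rfl fun p hp => ?_
    rw [Nat.factorization_def _ (mem_primesUpTo.mp hp).2]
  · intro p hp
    have hp' := Nat.support_factorization _ ▸ hp
    have hpr := Nat.prime_of_mem_primeFactors hp'
    exact mem_primesUpTo.mpr ⟨(hpr.dvd_factorial).mp (Nat.dvd_of_mem_primeFactors hp'), hpr⟩
  · simp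

lemma log_factorial_le (n : ℕ) : Real.log (n.factorial : ℝ) ≤ n * Real.log n := by
  have h : (n.factorial : ℝ) ≤ (n : ℝ) ^ n := by exact_mod_cast Nat.factorial_le_pow n
  calc _ ≤ Real.log ((n : ℝ) ^ n) := Real.log_le_log (by exact_mod_cast n.factorial_pos) h
    _ = _ := Real.log_pow n n

lemma le_log_factorial (n : ℕ) : n * Real.log n - n ≤ Real.log (n.factorial : ℝ) := by
  rcases Nat.eq_zero_or_pos n with rfl | hn
  · simp
  have h : (n : ℝ) ^ n / n.factorial ≤ Real.exp n := by
    have := Real.pow_div_factorial_le_exp (n : ℝ) n.cast_nonneg n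
    exact this
  have hf : (0 : ℝ) < n.factorial := by exact_mod_cast n.factorial_pos
  have hn' : (0 : ℝ) < n := by exact_mod_cast hn
  have h2 := Real.log_le_log (by positivity) h
  rw [Real.log_exp, Real.log_div (by positivity) hf.ne', Real.log_pow] at h2
  linarith

/-- The sum of `log p / p` over the primes `p ≤ n`. -/
noncomputable def primeLogSum (n : ℕ) : ℝ := ∑ p ∈ primesUpTo n, Real.log p / p

/-- The exponent of p in n! is at least ⌊n/p⌋ > n/p - 1, and n! ≤ nⁿ. The loss from the -1 is θ(n) ≤
n log 4. -/
lemma primeLogSum_le {n : ℕ} (hn : 1 ≤ n) : primeLogSum n ≤ Real.log n + Real.log 4 := by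
  have hn' : (0 : ℝ) < n := by exact_mod_cast hn
  have h1 : ∑ p ∈ primesUpTo n, ((n : ℝ) / p - 1) * Real.log p ≤ n * Real.log n := by
    refine le_trans ?_ (log_factorial_le n)
    rw [log_factorial_eq_sum]
    refine Finset.sum_le_sum fun p hp => ?_
    obtain ⟨hpn, hpr⟩ := mem_primesUpTo.mp hp
    have := Fact.mk hpr
    refine mul_le_mul_of_nonneg_right ?_ (Real.log_natCast_nonneg p)
    have h2 : n / p ≤ padicValNat p n.factorial := by
      rw [padicValNat_factorial (b := Nat.log p n + 2) (by omega)]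
      have := Finset.single_le_sum (f := fun i => n / p ^ i) (fun i _ => Nat.zero_le _)
        (show 1 ∈ Finset.Ico 1 (Nat.log p n + 2) by simp)
      simpa using this
    have h3 : (n : ℝ) / p < (n / p : ℕ) + 1 := by
      rw [← Nat.floor_div_eq_div (K := ℝ)]
      exact Nat.lt_floor_add_one _
    have h4 : ((n / p : ℕ) : ℝ) ≤ padicValNat p n.factorial := by exact_mod_cast h2
    linarith
  have h5 : ∑ p ∈ primesUpTo n, ((n : ℝ) / p - 1) * Real.log p =
      n * primeLogSum n - Chebyshev.theta n := by
    rw [theta_eq_sum_primesUpTo, primeLogSum, Finset.mul_sum, ← Finset.sum_sub_distrib]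
    exact Finset.sum_congr rfl fun p _ => by ring
  have h6 := Chebyshev.theta_le_log4_mul_x hn'.le
  rw [h5] at h1
  refine le_of_mul_le_mul_left ?_ hn'
  linarith

lemma summable_log_div_sq : Summable fun n : ℕ => Real.log n / (n : ℝ) ^ 2 := by
  have h : Summable fun n : ℕ => 2 * (1 / (n : ℝ) ^ (3 / 2 : ℝ)) :=
    (Real.summable_one_div_nat_rpow.mpr (by norm_num)).mul_left 2
  refine Summable.of_nonneg_of_le (fun n => ?_) (fun n => ?_) h
  · exact div_nonneg (Real.log_natCast_nonneg n) (by positivity)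
  · rcases Nat.eq_zero_or_pos n with rfl | hn
    · norm_num
    have hn' : (0 : ℝ) < n := by exact_mod_cast hn
    have h1 := Real.log_le_rpow_div hn'.le (show (0 : ℝ) < 1 / 2 by norm_num)
    rw [mul_one_div, div_le_div_iff₀ (by positivity) (by positivity)]
    have h2 : (n : ℝ) ^ 2 = (n : ℝ) ^ (1 / 2 : ℝ) * (n : ℝ) ^ (3 / 2 : ℝ) := by
      rw [← Real.rpow_add hn', ← Real.rpow_natCast]; norm_num
    rw [h2, ← mul_assoc]
    refine mul_le_mul_of_nonneg_right ?_ (by positivity)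
    calc _ ≤ _ := h1
      _ = _ := by ring

/-- Legendre's formula bounds the exponent of p in n! by n/(p - 1) ≤ n(1/p + 2/p²). The second term
contributes a convergent series, and n! ≥ (n/e)ⁿ accounts for the 1 in the constant. -/
lemma exists_le_primeLogSum : ∃ C : ℝ, ∀ n : ℕ, 1 ≤ n → Real.log n - C ≤ primeLogSum n := by
  refine ⟨1 + 2 * ∑' n : ℕ, Real.log n / (n : ℝ) ^ 2, fun n hn => ?_⟩
  have hn' : (0 : ℝ) < n := by exact_mod_cast hn
  have h1 : Real.log (n.factorial : ℝ) ≤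
      ∑ p ∈ primesUpTo n, ((n : ℝ) * (Real.log p / p) + n * (2 * (Real.log p / (p : ℝ) ^ 2))) := by
    rw [log_factorial_eq_sum]
    refine Finset.sum_le_sum fun p hp => ?_
    obtain ⟨hpn, hpr⟩ := mem_primesUpTo.mp hp
    have := Fact.mk hpr
    have h2 := sub_one_mul_padicValNat_factorial_lt_of_ne_zero p (n := n) (by omega)
    have hp2 : (2 : ℝ) ≤ p := by exact_mod_cast hpr.two_le
    have h3 : ((p : ℝ) - 1) * padicValNat p n.factorial ≤ n := by
      have h3 : (((p - 1) * padicValNat p n.factorial : ℕ) : ℝ) ≤ n := by exact_mod_cast h2.le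
      rwa [Nat.cast_mul, Nat.cast_sub hpr.one_lt.le, Nat.cast_one] at h3
    have h4 : (padicValNat p n.factorial : ℝ) ≤ n * (1 / p + 2 / (p : ℝ) ^ 2) := by
      have h5 : (padicValNat p n.factorial : ℝ) ≤ n / ((p : ℝ) - 1) := by
        rw [le_div_iff₀ (by linarith)]; linarith
      refine h5.trans ?_
      rw [div_eq_mul_one_div]
      refine mul_le_mul_of_nonneg_left ?_ hn'.le
      rw [div_add_div _ _ (by positivity) (by positivity), div_le_div_iff₀ (by linarith) (by positivity)]
      nlinarith [sq_nonneg ((p : ℝ)), mul_nonneg (sub_nonneg.mpr hp2) (sq_nonneg (p : ℝ)),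
        mul_nonneg (sub_nonneg.mpr hp2) (show (0 : ℝ) ≤ p by linarith)]
    calc _ ≤ n * (1 / p + 2 / (p : ℝ) ^ 2) * Real.log p :=
          mul_le_mul_of_nonneg_right h4 (Real.log_natCast_nonneg p)
      _ = _ := by ring
  have h6 : ∑ p ∈ primesUpTo n, Real.log p / (p : ℝ) ^ 2 ≤ ∑' n : ℕ, Real.log n / (n : ℝ) ^ 2 :=
    summable_log_div_sq.sum_le_tsum _ fun m _ =>
      div_nonneg (Real.log_natCast_nonneg m) (by positivity)
  rw [Finset.sum_add_distrib, ← Finset.mul_sum, ← Finset.mul_sum, ← Finset.mul_sum] at h1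
  have h7 := le_log_factorial n
  refine le_of_mul_le_mul_left ?_ hn'
  have h8 := mul_le_mul_of_nonneg_left h6 hn'.le
  change _ ≤ n * primeLogSum n + _ at h1
  linarith

/-- Mertens' first theorem. -/
lemma exists_abs_primeLogSum_sub_log_le :
    ∃ C : ℝ, 0 ≤ C ∧ ∀ n : ℕ, 1 ≤ n → |primeLogSum n - Real.log n| ≤ C := by
  obtain ⟨C, hC⟩ := exists_le_primeLogSum
  refine ⟨max C (Real.log 4), le_max_of_le_right (Real.log_nonneg (by norm_num)), fun n hn => ?_⟩
  rw [abs_le]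
  constructor
  · linarith [hC n hn, le_max_left C (Real.log 4)]
  · linarith [primeLogSum_le hn, le_max_right C (Real.log 4)]

/-! ### Mertens' second theorem, by partial summation. -/

/-- A sequence whose increments are dominated by those of a null sequence converges. -/
lemma exists_tendsto_of_abs_sub_le {E g : ℕ → ℝ} (hg : Tendsto g atTop (𝓝 0))
    (h : ∀ n, |E (n + 1) - E n| ≤ g n - g (n + 1)) : ∃ l, ∀ n, |E n - l| ≤ g n := by
  -- E + g decreases, E - g increases and their difference tends to 0, so both enclose a common
  -- limit.
  have h1 : Antitone fun n => E n + g n :=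
    antitone_nat_of_succ_le fun n => by linarith [(abs_le.mp (h n)).2]
  have h2 : Monotone fun n => E n - g n :=
    monotone_nat_of_le_succ fun n => by linarith [(abs_le.mp (h n)).1]
  have h0 : ∀ n, 0 ≤ g n := by
    have : Antitone g := antitone_nat_of_succ_le fun n => by linarith [(abs_nonneg _).trans (h n)]
    exact fun n => this.le_of_tendsto hg n
  have hb : BddBelow (Set.range fun n => E n + g n) := by
    refine ⟨E 0 - g 0, ?_⟩
    rintro _ ⟨n, rfl⟩
    have := h2 (Nat.zero_le n)
    simp only at this ⊢
    linarith [h0 n]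
  have h3 := tendsto_atTop_ciInf h1 hb
  have h4 := h3.sub (hg.const_mul 2)
  refine ⟨⨅ n, (E n + g n), fun n => abs_le.mpr ⟨?_, ?_⟩⟩
  · have := h1.le_of_tendsto h3 n
    linarith
  · have h5 : Tendsto (fun n => E n - g n) atTop (𝓝 (⨅ n, (E n + g n))) := by
      have : (fun n => E n - g n) = fun n => E n + g n - 2 * g n := by funext n; ring
      rw [this]; simpa using h4
    have := h2.ge_of_tendsto h5 n
    linarith

lemma primesUpTo_succ_of_prime {n : ℕ} (h : (n + 1).Prime) :
    primesUpTo (n + 1) = insert (n + 1) (primesUpTo n) := by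
  ext p
  simp only [mem_primesUpTo, Finset.mem_insert]
  constructor
  · rintro ⟨h1, h2⟩
    rcases Nat.lt_or_ge n p with h3 | h3
    · exact Or.inl (by omega)
    · exact Or.inr ⟨h3, h2⟩
  · rintro (rfl | h1)
    · exact ⟨le_rfl, h⟩
    · exact ⟨by omega, h1.2⟩

lemma primesUpTo_succ_of_not_prime {n : ℕ} (h : ¬ (n + 1).Prime) :
    primesUpTo (n + 1) = primesUpTo n := by
  ext p
  simp only [mem_primesUpTo]
  constructor
  · rintro ⟨h1, h2⟩
    refine ⟨?_, h2⟩
    by_contra h3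
    exact h ((show p = n + 1 by omega) ▸ h2)
  · exact fun h1 => ⟨by omega, h1.2⟩

lemma sum_inv_primesUpTo_succ_sub (n : ℕ) :
    ∑ p ∈ primesUpTo (n + 1), 1 / (p : ℝ) - ∑ p ∈ primesUpTo n, 1 / (p : ℝ) =
      (primeLogSum (n + 1) - primeLogSum n) / Real.log (n + 1 : ℕ) := by
  unfold primeLogSum
  by_cases h : (n + 1).Prime
  · have hnot : n + 1 ∉ primesUpTo n := fun h' => by have := (mem_primesUpTo.mp h').1; omega
    rw [primesUpTo_succ_of_prime h, Finset.sum_insert hnot, Finset.sum_insert hnot,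
      add_sub_cancel_right, add_sub_cancel_right]
    have : Real.log (n + 1 : ℕ) ≠ 0 := (Real.log_pos (by exact_mod_cast h.one_lt)).ne'
    field_simp
  · rw [primesUpTo_succ_of_not_prime h]; simp

lemma exists_abs_sum_inv_primesUpTo_sub_le : ∃ C l : ℝ, 0 ≤ C ∧ ∀ n : ℕ, 2 ≤ n →
    |∑ p ∈ primesUpTo n, 1 / (p : ℝ) - (Real.log (Real.log n) + l)| ≤ C / Real.log n := by
  obtain ⟨C, hC0, hC⟩ := exists_abs_primeLogSum_sub_log_le
  have hlogpos : ∀ n : ℕ, 2 ≤ n → 0 < Real.log n := fun n hn =>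
    Real.log_pos (by exact_mod_cast hn)
  -- Subtracting the boundary term of the partial summation leaves increments of size O(1/log n -
  -- 1/log(n+1)), which telescope.
  set E : ℕ → ℝ := fun n => ∑ p ∈ primesUpTo n, 1 / (p : ℝ) - Real.log (Real.log n) -
    (primeLogSum n - Real.log n) / Real.log n with hE
  have key : ∀ n : ℕ, 2 ≤ n → |E (n + 1) - E n| ≤
      (C + 1) / Real.log n - (C + 1) / Real.log (n + 1 : ℕ) := by
    intro n hn
    have ha := hlogpos n hn
    have hb := hlogpos (n + 1) (by omega)
    set a := Real.log n with hadef
    set b := Real.log (n + 1 : ℕ) with hbdef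
    have hn' : (2 : ℝ) ≤ n := by exact_mod_cast hn
    have hab : a ≤ b := Real.log_le_log (by linarith) (by push_cast; linarith)
    have hd : b - a ≤ 1 := by
      rw [hadef, hbdef, ← Real.log_div (by positivity) (by positivity)]
      have := Real.log_le_sub_one_of_pos (show (0 : ℝ) < (n + 1 : ℕ) / (n : ℝ) by positivity)
      refine this.trans ?_
      rw [sub_le_iff_le_add, div_le_iff₀ (by linarith)]
      push_cast; linarith
    have e1 : E (n + 1) - E n = ((b - a) / b - (Real.log b - Real.log a)) +
        (primeLogSum n - a) * (1 / a - 1 / b) := by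
      have := sum_inv_primesUpTo_succ_sub n
      simp only [hE]
      rw [← hadef, ← hbdef] at *
      rw [show ∑ p ∈ primesUpTo (n + 1), 1 / (p : ℝ) = ∑ p ∈ primesUpTo n, 1 / (p : ℝ) +
        (primeLogSum (n + 1) - primeLogSum n) / b by linarith]
      field_simp
      ring
    have hl : Real.log b - Real.log a = Real.log (b / a) := (Real.log_div hb.ne' ha.ne').symm
    have hl1 : Real.log (b / a) ≤ (b - a) / a := by
      have := Real.log_le_sub_one_of_pos (div_pos hb ha)
      rwa [show b / a - 1 = (b - a) / a by field_simp] at this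
    have hl2 : (b - a) / b ≤ Real.log (b / a) := by
      have := Real.one_sub_inv_le_log_of_pos (div_pos hb ha)
      rwa [show 1 - (b / a)⁻¹ = (b - a) / b by field_simp] at this
    have hinv : 0 ≤ 1 / a - 1 / b := sub_nonneg.mpr (one_div_le_one_div_of_le ha hab)
    rw [e1, hl]
    refine (abs_add_le _ _).trans ?_
    have h1 : |(b - a) / b - Real.log (b / a)| ≤ 1 / a - 1 / b := by
      rw [abs_of_nonpos (by linarith)]
      calc _ ≤ (b - a) / a - (b - a) / b := by linarith
        _ = (b - a) * (1 / a - 1 / b) := by ring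
        _ ≤ 1 * (1 / a - 1 / b) := mul_le_mul_of_nonneg_right hd hinv
        _ = _ := one_mul _
    have h2 : |(primeLogSum n - a) * (1 / a - 1 / b)| ≤ C * (1 / a - 1 / b) := by
      rw [abs_mul, abs_of_nonneg hinv]
      exact mul_le_mul_of_nonneg_right (hC n (by omega)) hinv
    calc _ ≤ _ := add_le_add h1 h2
      _ = _ := by ring
  -- The shift by 2 avoids the zeros of log n at n = 0 and n = 1.
  have hlim : Tendsto (fun n : ℕ => (C + 1) / Real.log (n + 2 : ℕ)) atTop (𝓝 0) :=
    ((tendsto_const_nhds.div_atTop (Real.tendsto_log_atTop.comp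
      tendsto_natCast_atTop_atTop)).comp (tendsto_add_atTop_nat 2))
  obtain ⟨l, hl⟩ := exists_tendsto_of_abs_sub_le (E := fun n => E (n + 2)) hlim
    fun n => key (n + 2) (by omega)
  refine ⟨C + 1 + C, l, by linarith, fun n hn => ?_⟩
  have h1 := hl (n - 2)
  simp only [show n - 2 + 2 = n by omega] at h1
  have ha := hlogpos n hn
  have h2 : |(primeLogSum n - Real.log n) / Real.log n| ≤ C / Real.log n := by
    rw [abs_div, abs_of_pos ha]
    exact div_le_div_of_nonneg_right (hC n (by omega)) ha.le
  have h3 : ∑ p ∈ primesUpTo n, 1 / (p : ℝ) - (Real.log (Real.log n) + l) =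
      (E n - l) + (primeLogSum n - Real.log n) / Real.log n := by
    simp only [hE]; ring
  rw [h3, add_div]
  exact (abs_add_le _ _).trans (add_le_add h1 h2)

lemma primeRecipSum_eq (x : ℝ) : primeRecipSum x = ∑ p ∈ primesUpTo ⌊x⌋₊, 1 / (p : ℝ) := rfl

lemma half_log_le_log_floor {x : ℝ} (hx : 2 ≤ x) : Real.log x / 2 ≤ Real.log ⌊x⌋₊ := by
  have h2 : 2 ≤ ⌊x⌋₊ := Nat.le_floor (by simpa using hx)
  have h2' : (2 : ℝ) ≤ ⌊x⌋₊ := by exact_mod_cast h2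
  have h3 := Nat.lt_floor_add_one x
  have h4 : Real.log x ≤ Real.log ((⌊x⌋₊ : ℝ) ^ 2) := Real.log_le_log (by linarith) (by nlinarith)
  rw [Real.log_pow] at h4
  push_cast at h4
  linarith

lemma exists_abs_primeRecipSum_sub_le : ∃ C l : ℝ, ∀ x : ℝ, 2 ≤ x →
    |primeRecipSum x - (Real.log (Real.log x) + l)| ≤ C / Real.log x := by
  obtain ⟨C, l, hC0, hC⟩ := exists_abs_sum_inv_primesUpTo_sub_le
  refine ⟨2 * C + 2, l, fun x hx => ?_⟩
  have h2 : 2 ≤ ⌊x⌋₊ := Nat.le_floor (by simpa using hx)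
  have h2' : (2 : ℝ) ≤ ⌊x⌋₊ := by exact_mod_cast h2
  have h1 := hC _ h2
  rw [← primeRecipSum_eq] at h1
  have hle : (⌊x⌋₊ : ℝ) ≤ x := Nat.floor_le (by linarith)
  have hlt := Nat.lt_floor_add_one x
  set a := Real.log (⌊x⌋₊ : ℝ)
  set b := Real.log x
  have ha : 0 < a := Real.log_pos (by linarith)
  have hb : 0 < b := Real.log_pos (by linarith)
  have hab : a ≤ b := Real.log_le_log (by linarith) hle
  have hba : b / 2 ≤ a := half_log_le_log_floor hx
  have hd : b - a ≤ 1 := by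
    rw [← Real.log_div (by positivity) (by positivity)]
    refine (Real.log_le_sub_one_of_pos (by positivity)).trans ?_
    rw [sub_le_iff_le_add, div_le_iff₀ (by linarith)]
    linarith
  have hl1 : Real.log b - Real.log a ≤ 1 / a := by
    rw [← Real.log_div hb.ne' ha.ne']
    refine (Real.log_le_sub_one_of_pos (div_pos hb ha)).trans ?_
    rw [show b / a - 1 = (b - a) / a by field_simp]
    exact div_le_div_of_nonneg_right hd ha.le
  have hl0 : Real.log a ≤ Real.log b := Real.log_le_log ha hab
  have hinv : 1 / a ≤ 2 / b := by
    rw [div_le_div_iff₀ ha hb]; linarith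
  have h3 : primeRecipSum x - (Real.log b + l) =
      (primeRecipSum x - (Real.log a + l)) - (Real.log b - Real.log a) := by ring
  rw [h3]
  refine (abs_sub _ _).trans ?_
  rw [abs_of_nonneg (show 0 ≤ Real.log b - Real.log a by linarith)]
  calc _ ≤ C / a + 1 / a := add_le_add h1 hl1
    _ = (C + 1) * (1 / a) := by ring
    _ ≤ (C + 1) * (2 / b) := mul_le_mul_of_nonneg_left hinv (by linarith)
    _ = _ := by ring

/-- Mertens' second theorem. -/
lemma exists_abs_primeRecipSum_sub_gammaStar_le : ∃ C : ℝ, ∀ x : ℝ, 2 ≤ x →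
    |primeRecipSum x - (Real.log (Real.log x) + gammaStar)| ≤ C / Real.log x := by
  obtain ⟨C, l, hC⟩ := exists_abs_primeRecipSum_sub_le
  -- `gammaStar` is a `limUnder`, so it is meaningful only once convergence is known; the limit l
  -- then identifies it.
  have hlim : Tendsto (fun x : ℝ => primeRecipSum x - Real.log (Real.log x)) atTop (𝓝 l) := by
    rw [tendsto_iff_norm_sub_tendsto_zero]
    refine squeeze_zero' (Eventually.of_forall fun _ => norm_nonneg _) ?_
      (tendsto_const_nhds (x := C).div_atTop Real.tendsto_log_atTop)
    filter_upwards [eventually_ge_atTop 2] with x hx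
    have := hC x hx
    rwa [Real.norm_eq_abs, sub_sub]
  have : gammaStar = l := hlim.limUnder_eq
  exact ⟨C, by rw [this]; exact hC⟩

end SymPow

/-! ### Chebyshev's bound and the error sums over p ≤ r and p > r. -/

namespace SymPow

lemma card_primesUpTo (n : ℕ) : (primesUpTo n).card = Nat.primeCounting n := by
  rw [← Nat.primesLE_card_eq_primeCounting]
  congr 1
  ext p
  simp [mem_primesUpTo, Nat.mem_primesLE]

lemma log_le_two_mul_sqrt {x : ℝ} (hx : 0 < x) : Real.log x ≤ 2 * √x := by
  have h := Real.log_le_sub_one_of_pos (Real.sqrt_pos.mpr hx)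
  rw [Real.log_sqrt hx.le] at h
  linarith

lemma sqrt_le_two_mul_div_log {x : ℝ} (hx : 1 < x) : √x ≤ 2 * x / Real.log x := by
  have h0 : 0 < x := by linarith
  rw [le_div_iff₀ (Real.log_pos hx)]
  have h := mul_le_mul_of_nonneg_left (log_le_two_mul_sqrt h0) (Real.sqrt_nonneg x)
  nlinarith [Real.mul_self_sqrt h0.le]

/-- Chebyshev's upper bound. -/
lemma card_primesUpTo_le {n : ℕ} (hn : 2 ≤ n) :
    ((primesUpTo n).card : ℝ) ≤ (2 * Real.log 4 + 2) * (n / Real.log n) := by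
  have hn' : (1 : ℝ) < n := by exact_mod_cast hn
  have h := Chebyshev.pi_le_log4_mul_div hn'
  rw [Nat.floor_natCast, ← card_primesUpTo, Real.log_sqrt (by linarith)] at h
  have h2 := sqrt_le_two_mul_div_log hn'
  have hl := Real.log_pos hn'
  calc _ ≤ _ := h
    _ ≤ Real.log 4 * n / (Real.log n / 2) + 2 * n / Real.log n := by linarith
    _ = _ := by field_simp

/-- Split at √n: beyond it 1/log k ≤ 2/log n, and below it there are at most √n = O(n / log n)
terms, each at most 1/log 2. -/
lemma sum_inv_log_le {n : ℕ} (hn : 2 ≤ n) :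
    ∑ k ∈ Finset.Icc 2 n, 1 / Real.log k ≤ (4 + 2 / Real.log 2) * (n / Real.log n) := by
  have hn' : (1 : ℝ) < n := by exact_mod_cast hn
  have hl := Real.log_pos hn'
  have hl2 : 0 < Real.log 2 := Real.log_pos (by norm_num)
  have hterm : ∀ k ∈ Finset.Icc 2 n, 1 / Real.log k ≤
      (if k ≤ Nat.sqrt n then 1 / Real.log 2 else 0) + 2 / Real.log n := by
    intro k hk
    have hk2 := (Finset.mem_Icc.mp hk).1
    have hk' : (2 : ℝ) ≤ k := by exact_mod_cast hk2
    split_ifs with h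
    · have := one_div_le_one_div_of_le hl2 (Real.log_le_log (by norm_num) hk')
      have : 0 ≤ 2 / Real.log n := by positivity
      linarith
    · rw [zero_add, div_le_div_iff₀ (Real.log_pos (by linarith)) hl]
      have h1 : n < k ^ 2 := by rw [sq]; exact Nat.sqrt_lt.mp (by omega)
      have h2 : (n : ℝ) ≤ (k : ℝ) ^ 2 := by exact_mod_cast h1.le
      have h3 := Real.log_le_log (by linarith) h2
      rw [Real.log_pow] at h3
      push_cast at h3
      linarith
  have hcard : ((Finset.Icc 2 n).card : ℝ) ≤ n := by
    rw [Nat.card_Icc]; exact_mod_cast (by omega)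
  have hcard2 : (((Finset.Icc 2 n).filter (· ≤ Nat.sqrt n)).card : ℝ) ≤ √n := by
    refine le_trans ?_ (Real.nat_sqrt_le_real_sqrt)
    have : (Finset.Icc 2 n).filter (· ≤ Nat.sqrt n) ⊆ Finset.Icc 1 (Nat.sqrt n) := by
      intro k hk
      simp only [Finset.mem_filter, Finset.mem_Icc] at hk ⊢
      omega
    have := Finset.card_le_card this
    rw [Nat.card_Icc] at this
    exact_mod_cast (by omega)
  calc _ ≤ _ := Finset.sum_le_sum hterm
    _ = ((Finset.Icc 2 n).filter (· ≤ Nat.sqrt n)).card * (1 / Real.log 2) +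
        (Finset.Icc 2 n).card * (2 / Real.log n) := by
      rw [Finset.sum_add_distrib, ← Finset.sum_filter, Finset.sum_const, Finset.sum_const,
        nsmul_eq_mul, nsmul_eq_mul]
    _ ≤ (2 * n / Real.log n) * (1 / Real.log 2) + n * (2 / Real.log n) := by
      gcongr
      exact hcard2.trans (sqrt_le_two_mul_div_log hn')
    _ ≤ _ := by
      have : 0 ≤ n / Real.log n := by positivity
      have e : (2 * n / Real.log n) * (1 / Real.log 2) + n * (2 / Real.log n) =
        (2 + 2 / Real.log 2) * (n / Real.log n) := by field_simp; ring
      rw [e]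
      nlinarith

lemma log_div_le_sum_inv {p n : ℕ} (hp : 1 ≤ p) (hpn : p ≤ n) :
    Real.log (n / p) ≤ ∑ k ∈ Finset.Ico p n, 1 / (k : ℝ) := by
  induction n, hpn using Nat.le_induction with
  | base =>
    have : (p : ℝ) ≠ 0 := by positivity
    simp [div_self this]
  | succ n hpn ih =>
    have hp' : (0 : ℝ) < p := by exact_mod_cast hp
    have hn' : (0 : ℝ) < n := by exact_mod_cast lt_of_lt_of_le hp hpn
    rw [Finset.sum_Ico_succ_top hpn]
    have h1 : ((n + 1 : ℕ) : ℝ) / p = (n / p) * ((n + 1 : ℕ) / n) := by field_simp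
    rw [h1, Real.log_mul (by positivity) (by positivity)]
    have h2 := Real.log_le_sub_one_of_pos (show (0 : ℝ) < (n + 1 : ℕ) / (n : ℝ) by positivity)
    have h3 : ((n + 1 : ℕ) : ℝ) / n - 1 = 1 / n := by push_cast; field_simp; ring
    linarith

/-- Exchanging the order of summation in a sum over primes `p` and integers `k ≥ p`. -/
lemma sum_sum_ite_le {T S : Finset ℕ} (hT : ∀ p ∈ T, p.Prime) {f : ℕ → ℝ} (hf : ∀ k, 0 ≤ f k) :
    ∑ p ∈ T, ∑ k ∈ S, (if p ≤ k then f k else 0) ≤ ∑ k ∈ S, (primesUpTo k).card * f k := by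
  rw [Finset.sum_comm]
  refine Finset.sum_le_sum fun k _ => ?_
  rw [← Finset.sum_filter, Finset.sum_const, nsmul_eq_mul]
  refine mul_le_mul_of_nonneg_right ?_ (hf k)
  exact_mod_cast Finset.card_le_card fun p hp =>
    mem_primesUpTo.mpr ⟨(Finset.mem_filter.mp hp).2, hT p (Finset.mem_filter.mp hp).1⟩

/-- `∑_{p ≤ r} (1 + log (r / p)) = O (r / log r)`. -/
lemma exists_sum_one_add_log_div_le : ∃ C : ℝ, ∀ r : ℝ, 2 ≤ r →
    ∑ p ∈ primesUpTo ⌊r⌋₊, (1 + Real.log (r / p)) ≤ C * (r / Real.log r) := by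
  set A := 2 * Real.log 4 + 2
  have hA : 0 ≤ A := by have := Real.log_nonneg (show (1 : ℝ) ≤ 4 by norm_num); positivity
  set B := 4 + 2 / Real.log 2
  have hB : 0 ≤ B := by have := Real.log_pos (show (1 : ℝ) < 2 by norm_num); positivity
  refine ⟨(2 * A + A * B) * 2, fun r hr => ?_⟩
  set n := ⌊r⌋₊ with hn
  have h2 : 2 ≤ n := Nat.le_floor (by simpa using hr)
  have h2' : (2 : ℝ) ≤ n := by exact_mod_cast h2
  have hle : (n : ℝ) ≤ r := Nat.floor_le (by linarith)
  have hlt := Nat.lt_floor_add_one r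
  -- Partial summation in disguise: log(n/p) is bounded by the sum of 1/k over p ≤ k < n. Exchanging
  -- the sums produces π(k)/k = O(1/log k).
  have hterm : ∀ p ∈ primesUpTo n, 1 + Real.log (r / p) ≤
      2 + ∑ k ∈ Finset.Icc 2 n, (if p ≤ k then 1 / (k : ℝ) else 0) := by
    intro p hp
    obtain ⟨hpn, hpr⟩ := mem_primesUpTo.mp hp
    have hp0 : (0 : ℝ) < p := by exact_mod_cast hpr.pos
    have e : r / p = (n / p) * (r / n) := by field_simp
    rw [e, Real.log_mul (by positivity) (by positivity)]
    have h3 : Real.log (r / n) ≤ 1 := by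
      refine (Real.log_le_sub_one_of_pos (by positivity)).trans ?_
      rw [sub_le_iff_le_add, div_le_iff₀ (by linarith)]
      linarith
    have h4 := log_div_le_sum_inv hpr.one_lt.le hpn
    have h5 : ∑ k ∈ Finset.Ico p n, 1 / (k : ℝ) ≤
        ∑ k ∈ Finset.Icc 2 n, (if p ≤ k then 1 / (k : ℝ) else 0) := by
      rw [← Finset.sum_filter]
      refine Finset.sum_le_sum_of_subset_of_nonneg (fun k hk => ?_) fun _ _ _ => by positivity
      have := hpr.two_le
      simp only [Finset.mem_filter, Finset.mem_Icc, Finset.mem_Ico] at hk ⊢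
      omega
    linarith
  have hl : 0 < Real.log n := Real.log_pos (by linarith)
  have hx : (n : ℝ) / Real.log n ≤ 2 * (r / Real.log r) := by
    have h6 := half_log_le_log_floor hr
    have hlr : 0 < Real.log r := Real.log_pos (by linarith)
    rw [← mul_div_assoc, div_le_div_iff₀ hl hlr]
    nlinarith
  calc _ ≤ _ := Finset.sum_le_sum hterm
    _ = 2 * (primesUpTo n).card +
        ∑ p ∈ primesUpTo n, ∑ k ∈ Finset.Icc 2 n, (if p ≤ k then 1 / (k : ℝ) else 0) := by
      rw [Finset.sum_add_distrib, Finset.sum_const, nsmul_eq_mul, mul_comm]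
    _ ≤ 2 * (A * (n / Real.log n)) + ∑ k ∈ Finset.Icc 2 n, (primesUpTo k).card * (1 / (k : ℝ)) :=
      add_le_add (mul_le_mul_of_nonneg_left (card_primesUpTo_le h2) (by norm_num))
        (sum_sum_ite_le (fun p hp => (mem_primesUpTo.mp hp).2) fun k => by positivity)
    _ ≤ 2 * (A * (n / Real.log n)) + ∑ k ∈ Finset.Icc 2 n, A * (1 / Real.log k) := by
      refine add_le_add le_rfl (Finset.sum_le_sum fun k hk => ?_)
      have hk2 := (Finset.mem_Icc.mp hk).1
      have hk0 : (0 : ℝ) < k := by exact_mod_cast (by omega : 0 < k)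
      calc _ ≤ A * (k / Real.log k) * (1 / (k : ℝ)) :=
            mul_le_mul_of_nonneg_right (card_primesUpTo_le hk2) (by positivity)
        _ = _ := by field_simp
    _ ≤ 2 * (A * (n / Real.log n)) + A * (B * (n / Real.log n)) := by
      rw [← Finset.mul_sum]
      gcongr
      exact sum_inv_log_le h2
    _ = (2 * A + A * B) * (n / Real.log n) := by ring
    _ ≤ (2 * A + A * B) * (2 * (r / Real.log r)) := mul_le_mul_of_nonneg_left hx (by positivity)
    _ = _ := by ring

/-- Writing p⁻² as a sum over k ≥ p allows the order of summation to be exchanged, which brings in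
π(k). The 8 is 2³, from k < 2p. -/
lemma inv_sq_le_sum_inv_cube {p : ℕ} (hp : 1 ≤ p) :
    1 / (p : ℝ) ^ 2 ≤ 8 * ∑ k ∈ Finset.Ico p (2 * p), 1 / (k : ℝ) ^ 3 := by
  have hp0 : (0 : ℝ) < p := by exact_mod_cast hp
  have h : ∑ k ∈ Finset.Ico p (2 * p), 1 / (2 * p : ℝ) ^ 3 ≤
      ∑ k ∈ Finset.Ico p (2 * p), 1 / (k : ℝ) ^ 3 := by
    refine Finset.sum_le_sum fun k hk => ?_
    obtain ⟨h1, h2⟩ := Finset.mem_Ico.mp hk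
    have hk0 : (0 : ℝ) < k := by exact_mod_cast (by omega : 0 < k)
    have hk2 : (k : ℝ) ≤ 2 * p := by exact_mod_cast h2.le
    exact one_div_le_one_div_of_le (by positivity) (by gcongr)
  rw [Finset.sum_const, Nat.card_Ico, nsmul_eq_mul, show 2 * p - p = p by omega] at h
  have e : (p : ℝ) * (1 / (2 * p : ℝ) ^ 3) = 1 / (p : ℝ) ^ 2 / 8 := by field_simp; norm_num
  linarith

/-- `∑_{p > r} p⁻² = O (1 / (r log r))`. -/
lemma exists_sum_inv_sq_le : ∃ C : ℝ, ∀ r : ℝ, 2 ≤ r → ∀ T : Finset ℕ,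
    (∀ p ∈ T, p.Prime ∧ r < p) → ∑ p ∈ T, 1 / (p : ℝ) ^ 2 ≤ C / (r * Real.log r) := by
  set A := 2 * Real.log 4 + 2
  have hA : 0 ≤ A := by have := Real.log_nonneg (show (1 : ℝ) ≤ 4 by norm_num); positivity
  refine ⟨8 * (A * 2), fun r hr T hT => ?_⟩
  obtain ⟨M, hM⟩ := T.exists_nat_subset_range
  have hlr : 0 < Real.log r := Real.log_pos (by linarith)
  have hrpos : 0 < r := by linarith
  -- Every p in T is below M, so S contains all the intervals [p, 2p).
  set S := Finset.Ioo ⌊r⌋₊ (2 * M)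
  have hmem : ∀ k ∈ S, r < k := fun k hk => by
    have := (Finset.mem_Ioo.mp hk).1
    exact (Nat.floor_lt hrpos.le).mp this
  have hterm : ∀ p ∈ T, 1 / (p : ℝ) ^ 2 ≤ 8 * ∑ k ∈ S, (if p ≤ k then 1 / (k : ℝ) ^ 3 else 0) := by
    intro p hp
    refine (inv_sq_le_sum_inv_cube (hT p hp).1.one_lt.le).trans ?_
    refine mul_le_mul_of_nonneg_left ?_ (by norm_num)
    rw [← Finset.sum_filter]
    refine Finset.sum_le_sum_of_subset_of_nonneg (fun k hk => ?_) fun _ _ _ => by positivity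
    have h1 := Finset.mem_range.mp (hM hp)
    have h2 := (Nat.floor_lt hrpos.le).mpr (hT p hp).2
    simp only [S, Finset.mem_filter, Finset.mem_Ioo, Finset.mem_Ico] at hk ⊢
    omega
  have hk' : ∀ k ∈ S, (primesUpTo k).card * (1 / (k : ℝ) ^ 3) ≤ A / Real.log r * ((k : ℝ) ^ 2)⁻¹ := by
    intro k hk
    have hrk := hmem k hk
    have hk0 : (0 : ℝ) < k := by linarith
    have hk2 : 2 ≤ k := by exact_mod_cast (hr.trans hrk.le)
    have hlk : Real.log r ≤ Real.log k := Real.log_le_log hrpos hrk.le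
    have hlk0 : 0 < Real.log k := hlr.trans_le hlk
    calc _ ≤ A * (k / Real.log k) * (1 / (k : ℝ) ^ 3) :=
          mul_le_mul_of_nonneg_right (card_primesUpTo_le hk2) (by positivity)
      _ = A / Real.log k * ((k : ℝ) ^ 2)⁻¹ := by field_simp
      _ ≤ _ := by gcongr
  calc _ ≤ _ := Finset.sum_le_sum hterm
    _ = 8 * ∑ p ∈ T, ∑ k ∈ S, (if p ≤ k then 1 / (k : ℝ) ^ 3 else 0) := by rw [Finset.mul_sum]
    _ ≤ 8 * ∑ k ∈ S, (primesUpTo k).card * (1 / (k : ℝ) ^ 3) :=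
      mul_le_mul_of_nonneg_left (sum_sum_ite_le (fun p hp => (hT p hp).1) fun k => by positivity)
        (by norm_num)
    _ ≤ 8 * ∑ k ∈ S, A / Real.log r * ((k : ℝ) ^ 2)⁻¹ :=
      mul_le_mul_of_nonneg_left (Finset.sum_le_sum hk') (by norm_num)
    _ ≤ 8 * (A / Real.log r * (2 / r)) := by
      rw [← Finset.mul_sum]
      have h1 := sum_Ioo_inv_sq_le (α := ℝ) ⌊r⌋₊ (2 * M)
      have h2 : 2 / ((⌊r⌋₊ : ℝ) + 1) ≤ 2 / r :=
        div_le_div_of_nonneg_left (by norm_num) hrpos (Nat.lt_floor_add_one r).le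
      have : 0 ≤ A / Real.log r := by positivity
      exact mul_le_mul_of_nonneg_left (mul_le_mul_of_nonneg_left (h1.trans h2) this) (by norm_num)
    _ = _ := by field_simp

/-- `∑_{n > r} n^{-3/2} = O (1 / log r)`. -/
lemma exists_sum_rpow_le : ∃ C : ℝ, ∀ r : ℝ, 2 ≤ r → ∀ T : Finset ℕ,
    (∀ p ∈ T, r < p) → ∑ p ∈ T, (p : ℝ) ^ (-(3 / 2) : ℝ) ≤ C / Real.log r := by
  refine ⟨4 * ∑' n : ℕ, 1 / (n : ℝ) ^ (5 / 4 : ℝ), fun r hr T hT => ?_⟩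
  have hl : 0 < Real.log r := Real.log_pos (by linarith)
  -- A factor p^(-1/4) ≤ r^(-1/4) ≤ 4/log r is given up; the remaining p^(-5/4) is summable over all
  -- integers.
  have h1 : ∀ p ∈ T, (p : ℝ) ^ (-(3 / 2) : ℝ) ≤ (4 / Real.log r) * (1 / (p : ℝ) ^ (5 / 4 : ℝ)) := by
    intro p hp
    have hpr := hT p hp
    have hp0 : (0 : ℝ) < p := by linarith
    have h2 : (p : ℝ) ^ (-(3 / 2) : ℝ) = (p : ℝ) ^ (-(1 / 4) : ℝ) * (1 / (p : ℝ) ^ (5 / 4 : ℝ)) := by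
      rw [one_div ((p : ℝ) ^ _), ← Real.rpow_neg hp0.le, ← Real.rpow_add hp0]; norm_num
    rw [h2]
    refine mul_le_mul_of_nonneg_right ?_ (by positivity)
    rw [Real.rpow_neg hp0.le, ← one_div, div_le_div_iff₀ (by positivity) hl, one_mul]
    have h3 := Real.log_le_rpow_div (show (0 : ℝ) ≤ r by linarith)
      (show (0 : ℝ) < 1 / 4 by norm_num)
    have h4 : r ^ (1 / 4 : ℝ) ≤ (p : ℝ) ^ (1 / 4 : ℝ) :=
      Real.rpow_le_rpow (by linarith) hpr.le (by norm_num)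
    linarith
  calc _ ≤ _ := Finset.sum_le_sum h1
    _ = (4 / Real.log r) * ∑ p ∈ T, 1 / (p : ℝ) ^ (5 / 4 : ℝ) := by rw [Finset.mul_sum]
    _ ≤ (4 / Real.log r) * ∑' n : ℕ, 1 / (n : ℝ) ^ (5 / 4 : ℝ) := by
      refine mul_le_mul_of_nonneg_left ?_ (by positivity)
      exact (Real.summable_one_div_nat_rpow.mpr (by norm_num)).sum_le_tsum _
        fun _ _ => by positivity
    _ = _ := by ring

end SymPow

namespace SymPow

/-! ### Diagonalisation, characters and characteristic polynomials -/

/-- Both are the inverse of g, because g is unitary of determinant 1. -/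
lemma conjTranspose_eq_adjugate (g : SU2) :
    (g : Matrix (Fin 2) (Fin 2) ℂ).conjTranspose = (g : Matrix (Fin 2) (Fin 2) ℂ).adjugate := by
  obtain ⟨hu, hd⟩ := Matrix.mem_specialUnitaryGroup_iff.mp g.2
  have h1 := Matrix.mem_unitaryGroup_iff'.mp hu
  rw [Matrix.star_eq_conjTranspose] at h1
  have h2 := Matrix.mul_adjugate (g : Matrix (Fin 2) (Fin 2) ℂ)
  rw [hd, one_smul] at h2
  calc _ = (g : Matrix (Fin 2) (Fin 2) ℂ).conjTranspose *
        ((g : Matrix (Fin 2) (Fin 2) ℂ) * (g : Matrix (Fin 2) (Fin 2) ℂ).adjugate) := by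
        rw [h2, mul_one]
    _ = _ := by rw [← mul_assoc, h1, one_mul]

lemma coe_one_one (g : SU2) :
    (g : Matrix (Fin 2) (Fin 2) ℂ) 1 1 = star ((g : Matrix (Fin 2) (Fin 2) ℂ) 0 0) := by
  have h := congrFun (congrFun (conjTranspose_eq_adjugate g) 0) 0
  rw [Matrix.conjTranspose_apply, Matrix.adjugate_fin_two] at h
  simpa using h.symm

lemma coe_zero_one (g : SU2) :
    (g : Matrix (Fin 2) (Fin 2) ℂ) 0 1 = -star ((g : Matrix (Fin 2) (Fin 2) ℂ) 1 0) := by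
  have h := congrFun (congrFun (conjTranspose_eq_adjugate g) 0) 1
  rw [Matrix.conjTranspose_apply, Matrix.adjugate_fin_two] at h
  simp only [Matrix.of_apply, Matrix.cons_val', Matrix.cons_val_zero, Matrix.cons_val_one,
    Matrix.cons_val_fin_one] at h
  rw [h, neg_neg]

/-- The trace of `g ∈ SU(2)`, as a real number. -/
noncomputable def tr (g : SU2) : ℝ := 2 * ((g : Matrix (Fin 2) (Fin 2) ℂ) 0 0).re

lemma trace_coe (g : SU2) : (g : Matrix (Fin 2) (Fin 2) ℂ).trace = (tr g : ℂ) := by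
  rw [Matrix.trace_fin_two, coe_one_one, tr]
  apply Complex.ext
  · simp; ring
  · simp

lemma normSq_add_normSq (g : SU2) :
    Complex.normSq ((g : Matrix (Fin 2) (Fin 2) ℂ) 0 0) +
      Complex.normSq ((g : Matrix (Fin 2) (Fin 2) ℂ) 1 0) = 1 := by
  have hd := (Matrix.mem_specialUnitaryGroup_iff.mp g.2).2
  rw [Matrix.det_fin_two, coe_one_one, coe_zero_one] at hd
  have h := congrArg Complex.re hd
  simp [Complex.normSq_apply] at h ⊢
  linarith

/-- A + A* is the scalar tr g, so A is an affine function of the Hermitian matrix H = i(A - A*), and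
the spectral theorem for H diagonalises A. -/
lemma exists_eq_mul_diagonal_mul (g : SU2) : ∃ (U V : Matrix (Fin 2) (Fin 2) ℂ) (α β : ℂ),
    U * V = 1 ∧ (g : Matrix (Fin 2) (Fin 2) ℂ) = U * Matrix.diagonal ![α, β] * V ∧
      α * β = 1 ∧ α + β = tr g := by
  set A := (g : Matrix (Fin 2) (Fin 2) ℂ) with hA
  set H : Matrix (Fin 2) (Fin 2) ℂ := Complex.I • (A - A.conjTranspose) with hH
  have hHerm : H.IsHermitian := by
    rw [Matrix.IsHermitian, hH, Matrix.conjTranspose_smul, Matrix.conjTranspose_sub,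
      Matrix.conjTranspose_conjTranspose]
    simp only [Complex.star_def, Complex.conj_I, neg_smul, smul_sub]
    abel
  have hadd : A + A.conjTranspose = (tr g : ℂ) • (1 : Matrix (Fin 2) (Fin 2) ℂ) := by
    rw [conjTranspose_eq_adjugate, ← trace_coe, Matrix.adjugate_fin_two, Matrix.trace_fin_two]
    ext i j
    fin_cases i <;> fin_cases j <;> simp [A, add_comm]
  obtain ⟨U, V, d0, d1, hUV, hd⟩ : ∃ (U V : Matrix (Fin 2) (Fin 2) ℂ) (d0 d1 : ℂ),
      U * V = 1 ∧ H = U * Matrix.diagonal ![d0, d1] * V := by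
    have h := hHerm.spectral_theorem
    rw [Unitary.conjStarAlgAut_apply] at h
    refine ⟨_, _, hHerm.eigenvalues 0, hHerm.eigenvalues 1,
      Unitary.mul_star_self_of_mem hHerm.eigenvectorUnitary.2, h.trans ?_⟩
    congr 3
    ext i
    fin_cases i <;> rfl
  have hAe : A = (tr g / 2 : ℂ) • (1 : Matrix (Fin 2) (Fin 2) ℂ) - (Complex.I / 2) • H := by
    have h1 : A.conjTranspose = (tr g : ℂ) • (1 : Matrix (Fin 2) (Fin 2) ℂ) - A :=
      eq_sub_of_add_eq' hadd
    rw [hH, h1]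
    ext i j
    simp only [Matrix.sub_apply, Matrix.smul_apply, smul_eq_mul]
    linear_combination ((1 / 2) * (A i j - (tr g * (1 : Matrix (Fin 2) (Fin 2) ℂ) i j - A i j))) *
      Complex.I_mul_I
  have hAd : A = U * Matrix.diagonal ![tr g / 2 - Complex.I / 2 * d0,
      tr g / 2 - Complex.I / 2 * d1] * V := by
    have h2 : Matrix.diagonal ![(tr g / 2 - Complex.I / 2 * d0 : ℂ), tr g / 2 - Complex.I / 2 * d1] =
        (tr g / 2 : ℂ) • (1 : Matrix (Fin 2) (Fin 2) ℂ) -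
          (Complex.I / 2) • Matrix.diagonal ![d0, d1] := by
      ext i j
      fin_cases i <;> fin_cases j <;> simp
    rw [h2, Matrix.mul_sub, Matrix.sub_mul, Matrix.mul_smul, Matrix.mul_one, Matrix.smul_mul, hUV,
      Matrix.mul_smul, Matrix.smul_mul, ← hd]
    exact hAe
  have hVU : V * U = 1 := mul_eq_one_comm.mp hUV
  refine ⟨U, V, _, _, hUV, hAd, ?_, ?_⟩
  · have hdet := (Matrix.mem_specialUnitaryGroup_iff.mp g.2).2
    rw [← hA, hAd, Matrix.det_mul, Matrix.det_mul, mul_right_comm, ← Matrix.det_mul, hUV,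
      Matrix.det_one, one_mul, Matrix.det_diagonal, Fin.prod_univ_two] at hdet
    exact hdet
  · have htr := trace_coe g
    rw [← hA, hAd, Matrix.trace_mul_comm, ← mul_assoc, hVU, one_mul, Matrix.trace_diagonal,
      Fin.sum_univ_two] at htr
    exact htr

lemma symMatrix_diagonal (m : ℕ) (α β : ℂ) : symMatrix m (Matrix.diagonal ![α, β]) =
    Matrix.diagonal fun j : Fin (m + 1) => α ^ (m - (j : ℕ)) * β ^ (j : ℕ) := by
  ext i j
  have h : symPoly m (Matrix.diagonal ![α, β]) j =
      Polynomial.C (α ^ (m - (j : ℕ)) * β ^ (j : ℕ)) * Polynomial.X ^ (j : ℕ) := by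
    simp [symPoly, mul_pow]
    ring
  simp only [symMatrix, Matrix.of_apply, h, Polynomial.coeff_C_mul, Polynomial.coeff_X_pow,
    Matrix.diagonal_apply, Fin.ext_iff]
  by_cases hij : (i : ℕ) = j
  · simp [hij]
  · simp [hij]

/-- The eigenvalues of `sym^m g` are `α ^ m, α ^ (m - 1) β, …, β ^ m` with `α β = 1` and
`α + β = tr g`. -/
lemma exists_eigenvalues (g : SU2) : ∃ α β : ℂ, α * β = 1 ∧ α + β = tr g ∧ ∀ m : ℕ,
    character (sym m) g = ∑ j : Fin (m + 1), α ^ (m - (j : ℕ)) * β ^ (j : ℕ) ∧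
    ∀ X : ℂ, eulerD X (sym m) g =
      (∏ j : Fin (m + 1), (1 - X * (α ^ (m - (j : ℕ)) * β ^ (j : ℕ))))⁻¹ := by
  obtain ⟨U, V, α, β, hUV, hg, h1, h2⟩ := exists_eq_mul_diagonal_mul g
  refine ⟨α, β, h1, h2, fun m => ?_⟩
  have hS : sym m g = symMatrix m U * (Matrix.diagonal fun j : Fin (m + 1) =>
      α ^ (m - (j : ℕ)) * β ^ (j : ℕ)) * symMatrix m V := by
    rw [← symMatrix_diagonal, ← symMatrix_mul, ← symMatrix_mul, ← hg]
    rfl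
  have hSUV : symMatrix m U * symMatrix m V = 1 := by rw [← symMatrix_mul, hUV, symMatrix_one]
  have hSVU : symMatrix m V * symMatrix m U = 1 := mul_eq_one_comm.mp hSUV
  constructor
  · rw [character, hS, Matrix.trace_mul_comm, ← mul_assoc, hSVU, one_mul, Matrix.trace_diagonal]
  · intro X
    have h3 : 1 - X • sym m g = symMatrix m U * (Matrix.diagonal fun j : Fin (m + 1) =>
        1 - X * (α ^ (m - (j : ℕ)) * β ^ (j : ℕ))) * symMatrix m V := by
      have h4 : (Matrix.diagonal fun j : Fin (m + 1) =>
          1 - X * (α ^ (m - (j : ℕ)) * β ^ (j : ℕ))) = 1 - X • (Matrix.diagonal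
            fun j : Fin (m + 1) => α ^ (m - (j : ℕ)) * β ^ (j : ℕ)) := by
        rw [← Matrix.diagonal_one, ← Matrix.diagonal_smul, Matrix.diagonal_sub]
        rfl
      rw [h4, Matrix.mul_sub, Matrix.sub_mul, mul_one, hSUV, Matrix.mul_smul, Matrix.smul_mul, ← hS]
    rw [eulerD, h3, Matrix.det_mul, Matrix.det_mul, mul_right_comm, ← Matrix.det_mul, hSUV,
      Matrix.det_one, one_mul, Matrix.det_diagonal]

/-- The quadratic `1 - s X + X²`. -/
def quad (X s : ℝ) : ℝ := 1 - s * X + X ^ 2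

lemma character_sym_one (g : SU2) : character (sym 1) g = (tr g : ℝ) := by
  obtain ⟨α, β, h1, h2, h⟩ := exists_eigenvalues g
  rw [(h 1).1, Fin.sum_univ_two, ← h2]
  simp

lemma character_sym_two (g : SU2) : character (sym 2) g = (tr g ^ 2 - 1 : ℝ) := by
  obtain ⟨α, β, h1, h2, h⟩ := exists_eigenvalues g
  rw [(h 2).1, Fin.sum_univ_three]
  push_cast
  rw [← h2]
  simp
  linear_combination (-1) * h1

lemma character_sym_four (g : SU2) :
    character (sym 4) g = (tr g ^ 4 - 3 * tr g ^ 2 + 1 : ℝ) := by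
  obtain ⟨α, β, h1, h2, h⟩ := exists_eigenvalues g
  have hβ : β = tr g - α := eq_sub_of_add_eq' h2
  rw [(h 4).1, Fin.sum_univ_five]
  push_cast
  rw [← h2]
  simp
  linear_combination (-3 * α ^ 2 - 3 * β ^ 2 - 5 * α * β + 1) * h1

lemma ofReal_quad {X s : ℝ} {a b : ℂ} (h1 : a * b = 1) (h2 : a + b = s) :
    (quad X s : ℂ) = (1 - X * a) * (1 - X * b) := by
  rw [quad]
  push_cast
  rw [← h2]
  linear_combination (-(X : ℂ) ^ 2) * h1

/-- Squaring the eigenvalues acts on the trace by s ↦ s² - 2. Applied once and twice, this gives the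
quadratic factors of sym² and sym⁴. -/
lemma sq_add_sq_eq {s : ℝ} {a b : ℂ} (h1 : a * b = 1) (h2 : a + b = s) :
    a ^ 2 * b ^ 2 = 1 ∧ a ^ 2 + b ^ 2 = (s ^ 2 - 2 : ℝ) := by
  push_cast
  rw [← h2]
  exact ⟨by linear_combination (a * b + 1) * h1, by linear_combination (-2) * h1⟩

lemma eulerD_sym_one (X : ℝ) (g : SU2) : eulerD X (sym 1) g = ((quad X (tr g))⁻¹ : ℝ) := by
  obtain ⟨α, β, h1, h2, h⟩ := exists_eigenvalues g
  rw [(h 1).2, Fin.prod_univ_two, Complex.ofReal_inv, ofReal_quad h1 h2]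
  simp

lemma eulerD_sym_two (X : ℝ) (g : SU2) :
    eulerD X (sym 2) g = (((1 - X) * quad X (tr g ^ 2 - 2))⁻¹ : ℝ) := by
  obtain ⟨α, β, h1, h2, h⟩ := exists_eigenvalues g
  obtain ⟨h3, h4⟩ := sq_add_sq_eq h1 h2
  rw [(h 2).2, Fin.prod_univ_three, Complex.ofReal_inv, Complex.ofReal_mul, ofReal_quad h3 h4]
  simp [h1]
  ring

lemma eulerD_sym_four (X : ℝ) (g : SU2) : eulerD X (sym 4) g =
    (((1 - X) * quad X (tr g ^ 2 - 2) * quad X ((tr g ^ 2 - 2) ^ 2 - 2))⁻¹ : ℝ) := by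
  obtain ⟨α, β, h1, h2, h⟩ := exists_eigenvalues g
  obtain ⟨h3, h4⟩ := sq_add_sq_eq h1 h2
  obtain ⟨h5, h6⟩ := sq_add_sq_eq h3 h4
  have e1 : α ^ 3 * β = α ^ 2 := by linear_combination α ^ 2 * h1
  have e3 : α * β ^ 3 = β ^ 2 := by linear_combination β ^ 2 * h1
  rw [(h 4).2, Fin.prod_univ_five, Complex.ofReal_inv, Complex.ofReal_mul, Complex.ofReal_mul,
    ofReal_quad h3 h4, ofReal_quad h5 h6]
  simp [e1, h3, e3]
  ring

lemma eulerD_st (X : ℝ) (g : SU2) : eulerD X st g = ((quad X (tr g))⁻¹ : ℝ) := by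
  have hd := (Matrix.mem_specialUnitaryGroup_iff.mp g.2).2
  have ht := trace_coe g
  rw [Matrix.trace_fin_two] at ht
  rw [Matrix.det_fin_two] at hd
  rw [eulerD, Complex.ofReal_inv, quad]
  congr 1
  push_cast
  rw [← ht, Matrix.det_fin_two]
  simp [st]
  linear_combination (X : ℂ) ^ 2 * hd

end SymPow

namespace SymPow

/-! ### Haar measure: moments of the trace and measures of balls -/

instance instIsMulLeftInvariantHaarSU2 : haarSU2.IsMulLeftInvariant := by
  unfold haarSU2; infer_instance

instance instIsProbabilityMeasureHaarSU2 : IsProbabilityMeasure haarSU2 := by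
  refine ⟨?_⟩
  have h := Measure.haarMeasure_self (K₀ := (⊤ : TopologicalSpace.PositiveCompacts SU2))
  rwa [TopologicalSpace.PositiveCompacts.coe_top] at h

lemma continuous_tr : Continuous tr := by
  unfold tr
  have h : Continuous fun g : SU2 => (g : Matrix (Fin 2) (Fin 2) ℂ) 0 0 :=
    continuous_subtype_val.matrix_elem 0 0
  exact continuous_const.mul (Complex.continuous_re.comp h)

lemma abs_tr_le (g : SU2) : |tr g| ≤ 2 := by
  have h := normSq_add_normSq g
  have h2 := Complex.normSq_nonneg ((g : Matrix (Fin 2) (Fin 2) ℂ) 1 0)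
  rw [Complex.normSq_apply] at h
  rw [tr, abs_le]
  constructor <;> nlinarith [sq_nonneg ((g : Matrix (Fin 2) (Fin 2) ℂ) 0 0).im]

/-- The element of `SU(2)` with first row `(u, v)`. -/
noncomputable def ofRow (u v : ℂ) (h : Complex.normSq u + Complex.normSq v = 1) : SU2 :=
  ⟨!![u, v; -star v, star u], by
    have h' : u * star u + v * star v = 1 := by
      simp only [Complex.star_def, Complex.mul_conj]
      exact_mod_cast h
    rw [Matrix.mem_specialUnitaryGroup_iff, Matrix.mem_unitaryGroup_iff]
    constructor
    · ext i j
      fin_cases i <;> fin_cases j <;> simp [Matrix.mul_apply, Matrix.star_apply] at h' ⊢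
      · exact h'
      · ring
      · ring
      · linear_combination h'
    · rw [Matrix.det_fin_two_of]
      linear_combination h'⟩

lemma tr_ofRow_mul (u v : ℂ) (h : Complex.normSq u + Complex.normSq v = 1) (g : SU2) :
    tr (ofRow u v h * g) = 2 * (u * (g : Matrix (Fin 2) (Fin 2) ℂ) 0 0 +
      v * (g : Matrix (Fin 2) (Fin 2) ℂ) 1 0).re := by
  rw [tr, Submonoid.coe_mul, Matrix.mul_apply, Fin.sum_univ_two]
  rfl

/-- Left translation turns the trace into twice any unit real-linear form on the first column, a
point of S³. Moments of the trace thus reduce to averages over finitely many unit vectors. -/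
lemma integral_tr_ofRow (f : ℝ → ℝ) (u v : ℂ) (h : Complex.normSq u + Complex.normSq v = 1) :
    ∫ g : SU2, f (2 * (u * (g : Matrix (Fin 2) (Fin 2) ℂ) 0 0 +
      v * (g : Matrix (Fin 2) (Fin 2) ℂ) 1 0).re) ∂haarSU2 = ∫ g, f (tr g) ∂haarSU2 := by
  rw [← integral_mul_left_eq_self (μ := haarSU2) (fun g => f (tr g)) (ofRow u v h)]
  simp only [tr_ofRow_mul]

lemma integrable_of_continuous {f : SU2 → ℝ} (hf : Continuous f) : Integrable f haarSU2 :=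
  hf.integrable_of_hasCompactSupport (HasCompactSupport.of_compactSpace f)

lemma integral_tr : ∫ g, tr g ∂haarSU2 = 0 := by
  have h := integral_tr_ofRow id (-1) 0 (by simp)
  have e : ∀ g : SU2, id (2 * ((-1) * (g : Matrix (Fin 2) (Fin 2) ℂ) 0 0 +
      0 * (g : Matrix (Fin 2) (Fin 2) ℂ) 1 0).re) = -tr g := fun g => by simp [tr]
  rw [integral_congr_ae (Eventually.of_forall e), integral_neg] at h
  simp only [id] at h
  linarith

/-- Summing an invariance relation over a finite subset of `SU(2)`. -/
lemma integral_tr_pow_eq {ι : Type*} (s : Finset ι) (n : ℕ) (u v : ι → ℂ) (c : ℝ)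
    (h : ∀ i, Complex.normSq (u i) + Complex.normSq (v i) = 1)
    (hc : ∀ g : SU2, ∑ i ∈ s, (2 * (u i * (g : Matrix (Fin 2) (Fin 2) ℂ) 0 0 +
      v i * (g : Matrix (Fin 2) (Fin 2) ℂ) 1 0).re) ^ n = c) :
    s.card * ∫ g, tr g ^ n ∂haarSU2 = c := by
  have h1 : ∫ g : SU2, ∑ i ∈ s, (2 * (u i * (g : Matrix (Fin 2) (Fin 2) ℂ) 0 0 +
      v i * (g : Matrix (Fin 2) (Fin 2) ℂ) 1 0).re) ^ n ∂haarSU2 = c := by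
    simp only [hc, integral_const, probReal_univ, one_smul]
  rw [integral_finsetSum] at h1
  · rw [← h1, ← nsmul_eq_mul, ← Finset.sum_const]
    exact Finset.sum_congr rfl fun i _ => (integral_tr_ofRow (· ^ n) (u i) (v i) (h i)).symm
  · intro i _
    apply integrable_of_continuous
    simp only [← tr_ofRow_mul (u i) (v i) (h i)]
    exact (continuous_tr.comp (continuous_const_mul _)).pow n

/-- For the four unit quaternions 1, i, j, k the squared forms add up to 4 times the squared norm of
the column, which is 1. -/
lemma integral_tr_sq : ∫ g, tr g ^ 2 ∂haarSU2 = 1 := by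
  have h := integral_tr_pow_eq (Finset.univ : Finset (Fin 4)) 2 ![1, Complex.I, 0, 0]
    ![0, 0, 1, Complex.I] 4 (fun i => by fin_cases i <;> simp) (fun g => by
      have h := normSq_add_normSq g
      simp only [Complex.normSq_apply] at h
      simp [Fin.sum_univ_four]
      linarith)
  simp at h
  linarith

/-- The invariance is summed over the 24 Hurwitz units, taken up to sign. -/
lemma integral_tr_pow_four : ∫ g, tr g ^ 4 ∂haarSU2 = 2 := by
  have h := integral_tr_pow_eq (Finset.univ : Finset (Fin 12)) 4
    ![1, Complex.I, 0, 0, ⟨1/2, 1/2⟩, ⟨1/2, 1/2⟩, ⟨1/2, 1/2⟩, ⟨1/2, 1/2⟩,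
      ⟨1/2, -1/2⟩, ⟨1/2, -1/2⟩, ⟨1/2, -1/2⟩, ⟨1/2, -1/2⟩]
    ![0, 0, 1, Complex.I, ⟨1/2, 1/2⟩, ⟨1/2, -1/2⟩, ⟨-1/2, 1/2⟩, ⟨-1/2, -1/2⟩,
      ⟨1/2, 1/2⟩, ⟨1/2, -1/2⟩, ⟨-1/2, 1/2⟩, ⟨-1/2, -1/2⟩] 24
    (fun i => by fin_cases i <;> simp [Complex.normSq_apply] <;> norm_num) (fun g => by
      have h := normSq_add_normSq g
      simp only [Complex.normSq_apply] at h
      simp [Fin.sum_univ_succ]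
      -- With S the squared norm of the column, the twelve fourth powers add up to 24 S², and S² - 1
      -- = (S + 1)(S - 1).
      linear_combination 24 * (((g : Matrix (Fin 2) (Fin 2) ℂ) 0 0).re ^ 2 +
        ((g : Matrix (Fin 2) (Fin 2) ℂ) 0 0).im ^ 2 + ((g : Matrix (Fin 2) (Fin 2) ℂ) 1 0).re ^ 2 +
        ((g : Matrix (Fin 2) (Fin 2) ℂ) 1 0).im ^ 2 + 1) * h)
  simp at h
  linarith

/-! ### Lower bound for the Haar measure of trace neighbourhoods. -/

lemma tr_mul (k g : SU2) : tr (k * g) = 2 * ((k : Matrix (Fin 2) (Fin 2) ℂ) 0 0 *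
    (g : Matrix (Fin 2) (Fin 2) ℂ) 0 0 + (k : Matrix (Fin 2) (Fin 2) ℂ) 0 1 *
      (g : Matrix (Fin 2) (Fin 2) ℂ) 1 0).re := by
  rw [tr, Submonoid.coe_mul, Matrix.mul_apply, Fin.sum_univ_two]

lemma norm_coe_le_one (g : SU2) (i j : Fin 2) : ‖(g : Matrix (Fin 2) (Fin 2) ℂ) i j‖ ≤ 1 :=
  entry_norm_bound_of_unitary (Matrix.specialUnitaryGroup_le_unitaryGroup g.2) i j

/-- The bound is uniform in k, so closeness of first columns survives every left translation. -/
lemma abs_tr_mul_sub_le (k g h : SU2) : |tr (k * g) - tr (k * h)| ≤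
    2 * (‖(g : Matrix (Fin 2) (Fin 2) ℂ) 0 0 - (h : Matrix (Fin 2) (Fin 2) ℂ) 0 0‖ +
      ‖(g : Matrix (Fin 2) (Fin 2) ℂ) 1 0 - (h : Matrix (Fin 2) (Fin 2) ℂ) 1 0‖) := by
  set a := (k : Matrix (Fin 2) (Fin 2) ℂ) 0 0
  set b := (k : Matrix (Fin 2) (Fin 2) ℂ) 0 1
  have e : tr (k * g) - tr (k * h) = 2 * (a * ((g : Matrix (Fin 2) (Fin 2) ℂ) 0 0 -
      (h : Matrix (Fin 2) (Fin 2) ℂ) 0 0) + b * ((g : Matrix (Fin 2) (Fin 2) ℂ) 1 0 -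
      (h : Matrix (Fin 2) (Fin 2) ℂ) 1 0)).re := by
    rw [tr_mul, tr_mul]
    simp only [Complex.add_re, Complex.mul_re, Complex.sub_re, Complex.sub_im]
    ring
  rw [e, abs_mul, abs_two]
  refine mul_le_mul_of_nonneg_left ?_ (by norm_num)
  refine (Complex.abs_re_le_norm _).trans ((norm_add_le _ _).trans ?_)
  rw [norm_mul, norm_mul]
  exact add_le_add (mul_le_of_le_one_left (norm_nonneg _) (norm_coe_le_one k 0 0))
    (mul_le_of_le_one_left (norm_nonneg _) (norm_coe_le_one k 0 1))

/-- The cell of `g` in the grid of mesh `1 / N`, in terms of the first column of `g`. -/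
noncomputable def cell (N : ℕ) (g : SU2) : (ℤ × ℤ) × (ℤ × ℤ) :=
  ((⌊N * ((g : Matrix (Fin 2) (Fin 2) ℂ) 0 0).re⌋, ⌊N * ((g : Matrix (Fin 2) (Fin 2) ℂ) 0 0).im⌋),
    (⌊N * ((g : Matrix (Fin 2) (Fin 2) ℂ) 1 0).re⌋, ⌊N * ((g : Matrix (Fin 2) (Fin 2) ℂ) 1 0).im⌋))

/-- The finite set of cells which meet `SU(2)`. -/
noncomputable def cells (N : ℕ) : Finset ((ℤ × ℤ) × (ℤ × ℤ)) :=
  (Finset.Icc (-N : ℤ) N ×ˢ Finset.Icc (-N : ℤ) N) ×ˢ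
    (Finset.Icc (-N : ℤ) N ×ˢ Finset.Icc (-N : ℤ) N)

lemma card_cells (N : ℕ) : (cells N).card = (2 * N + 1) ^ 4 := by
  have h : (Finset.Icc (-N : ℤ) N).card = 2 * N + 1 := by rw [Int.card_Icc]; omega
  rw [cells, Finset.card_product, Finset.card_product, h]
  ring

lemma floor_mem_Icc {N : ℕ} {x : ℝ} (hx : |x| ≤ 1) : ⌊N * x⌋ ∈ Finset.Icc (-N : ℤ) N := by
  obtain ⟨h1, h2⟩ := abs_le.mp hx
  have hN : (0 : ℝ) ≤ N := N.cast_nonneg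
  rw [Finset.mem_Icc]
  constructor
  · rw [Int.le_floor]; push_cast; nlinarith
  · have : (⌊N * x⌋ : ℝ) ≤ N := (Int.floor_le _).trans (by nlinarith)
    exact_mod_cast this

lemma cell_mem_cells (N : ℕ) (g : SU2) : cell N g ∈ cells N := by
  have hre : ∀ i j, |((g : Matrix (Fin 2) (Fin 2) ℂ) i j).re| ≤ 1 := fun i j =>
    (Complex.abs_re_le_norm _).trans (norm_coe_le_one g i j)
  have him : ∀ i j, |((g : Matrix (Fin 2) (Fin 2) ℂ) i j).im| ≤ 1 := fun i j =>
    (Complex.abs_im_le_norm _).trans (norm_coe_le_one g i j)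
  simp only [cells, cell, Finset.mem_product]
  exact ⟨⟨floor_mem_Icc (hre 0 0), floor_mem_Icc (him 0 0)⟩,
    ⟨floor_mem_Icc (hre 1 0), floor_mem_Icc (him 1 0)⟩⟩

lemma abs_sub_le_of_floor_eq {N : ℕ} (hN : 0 < N) {x y : ℝ} (h : ⌊N * x⌋ = ⌊N * y⌋) :
    |x - y| ≤ 1 / N := by
  have hN' : (0 : ℝ) < N := by exact_mod_cast hN
  have h1 := Int.abs_sub_lt_one_of_floor_eq_floor h
  rw [← mul_sub, abs_mul, abs_of_pos hN'] at h1
  rw [le_div_iff₀ hN']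
  linarith

lemma abs_tr_mul_sub_le_of_cell_eq {N : ℕ} (hN : 0 < N) (k : SU2) {g h : SU2}
    (hgh : cell N g = cell N h) : |tr (k * g) - tr (k * h)| ≤ 8 / N := by
  simp only [cell, Prod.mk.injEq] at hgh
  obtain ⟨⟨h1, h2⟩, h3, h4⟩ := hgh
  have a1 := abs_sub_le_of_floor_eq hN h1
  have a2 := abs_sub_le_of_floor_eq hN h2
  have a3 := abs_sub_le_of_floor_eq hN h3
  have a4 := abs_sub_le_of_floor_eq hN h4
  have b1 := Complex.norm_le_abs_re_add_abs_im
    ((g : Matrix (Fin 2) (Fin 2) ℂ) 0 0 - (h : Matrix (Fin 2) (Fin 2) ℂ) 0 0)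
  have b2 := Complex.norm_le_abs_re_add_abs_im
    ((g : Matrix (Fin 2) (Fin 2) ℂ) 1 0 - (h : Matrix (Fin 2) (Fin 2) ℂ) 1 0)
  rw [Complex.sub_re, Complex.sub_im] at b1 b2
  have e : (8 : ℝ) / N = 2 * (4 * (1 / N)) := by ring
  have := abs_tr_mul_sub_le k g h
  linarith

/-- Pigeonhole: (2N + 1)⁴ cells cover a space of total mass 1. -/
lemma exists_le_measure_cell (N : ℕ) :
    ∃ h : SU2, 1 / ((2 * N + 1 : ℝ) ^ 4) ≤ haarSU2.real {g | cell N g = cell N h} := by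
  by_contra! hcon
  have hcov : (Set.univ : Set SU2) ⊆ ⋃ c ∈ cells N, {g | cell N g = c} := fun g _ => by
    simp only [Set.mem_iUnion]
    exact ⟨cell N g, cell_mem_cells N g, rfl⟩
  have h1 : (1 : ℝ) ≤ ∑ c ∈ cells N, haarSU2.real {g | cell N g = c} := by
    rw [← probReal_univ (μ := haarSU2)]
    exact (measureReal_mono hcov (measure_ne_top _ _)).trans (measureReal_biUnion_finset_le _ _)
  have h2 : ∀ c ∈ cells N, haarSU2.real {g | cell N g = c} < 1 / ((2 * N + 1 : ℝ) ^ 4) := by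
    intro c _
    by_cases hc : ∃ h, cell N h = c
    · obtain ⟨h, rfl⟩ := hc
      exact hcon h
    · have : {g | cell N g = c} = ∅ := by
        ext g
        simpa using fun hg => hc ⟨g, hg⟩
      rw [this, measureReal_empty]
      positivity
  have h3 := Finset.sum_lt_sum_of_nonempty ⟨_, cell_mem_cells N 1⟩ h2
  rw [Finset.sum_const, card_cells, nsmul_eq_mul] at h3
  push_cast at h3
  rw [mul_one_div_cancel (by positivity)] at h3
  linarith

/-- The trace is within `δ` of `tr g₀` on a set of measure `≫ δ ^ 4`. -/
lemma le_measure_abs_tr_sub_le (g₀ : SU2) {δ : ℝ} (h0 : 0 < δ) (h1 : δ ≤ 1) :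
    (δ / 27) ^ 4 ≤ haarSU2.real {g | |tr g - tr g₀| ≤ δ} := by
  -- This mesh makes the trace variation 8/N at most δ. Since δ ≤ 1, 2N + 1 ≤ 19/δ, so 27 leaves
  -- room.
  set N := ⌈8 / δ⌉₊ with hN
  have hN0 : 0 < N := Nat.ceil_pos.mpr (by positivity)
  have hN1 : 8 / δ ≤ N := Nat.le_ceil _
  have hN2 : (N : ℝ) < 8 / δ + 1 := Nat.ceil_lt_add_one (by positivity)
  have hN' : (0 : ℝ) < N := by exact_mod_cast hN0
  obtain ⟨h, hh⟩ := exists_le_measure_cell N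
  have hδ : 1 ≤ 1 / δ := (one_le_div h0).mpr h1
  have e8 : 8 / δ = 8 * (1 / δ) := by ring
  calc (δ / 27) ^ 4 ≤ 1 / ((2 * N + 1 : ℝ) ^ 4) := by
        rw [← one_div_pow]
        refine pow_le_pow_left₀ (by positivity) ?_ 4
        rw [div_le_div_iff₀ (by norm_num) (by positivity)]
        have : (2 * N + 1 : ℝ) ≤ 19 * (1 / δ) := by linarith
        calc _ ≤ δ * (19 * (1 / δ)) := mul_le_mul_of_nonneg_left this h0.le
          _ = 19 := by field_simp
          _ ≤ _ := by norm_num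
    _ ≤ _ := hh
    -- Translation by g₀h⁻¹ carries h to g₀, hence the whole cell of h into the trace neighbourhood
    -- of g₀.
    _ ≤ haarSU2.real ((fun g => g₀ * h⁻¹ * g) ⁻¹' {g | |tr g - tr g₀| ≤ δ}) := by
        refine measureReal_mono fun g hg => ?_
        have := abs_tr_mul_sub_le_of_cell_eq hN0 (g₀ * h⁻¹) hg
        rw [inv_mul_cancel_right] at this
        refine this.trans ?_
        rw [div_le_iff₀ hN', ← div_le_iff₀' h0]
        exact hN1
    _ = _ := by
        rw [Measure.real, measure_preimage_mul]
        rfl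

end SymPow

namespace SymPow

/-! ### Local factors -/

/-- The primes up to `r`, as a finite set of elements of `Nat.Primes`. -/
noncomputable def primesLe (r : ℝ) : Finset Nat.Primes :=
  (primesUpTo ⌊r⌋₊).preimage (fun p : Nat.Primes => (p : ℕ)) Nat.Primes.coe_nat_injective.injOn

lemma mem_primesLe {r : ℝ} (hr : 0 ≤ r) {p : Nat.Primes} : p ∈ primesLe r ↔ (p : ℝ) ≤ r := by
  have h : p ∈ primesLe r ↔ (p : ℕ) ≤ ⌊r⌋₊ ∧ (p : ℕ).Prime :=
    Finset.mem_preimage.trans mem_primesUpTo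
  rw [h]
  exact ⟨fun h => (Nat.le_floor_iff hr).mp h.1, fun h => ⟨(Nat.le_floor_iff hr).mpr h, p.2⟩⟩

lemma sum_primesLe (r : ℝ) (f : ℕ → ℝ) :
    ∑ p ∈ primesLe r, f p = ∑ p ∈ primesUpTo ⌊r⌋₊, f p := by
  rw [primesLe]
  exact Finset.sum_preimage (fun p : Nat.Primes => (p : ℕ)) _ _ f
    fun p hp hn => absurd ⟨⟨p, (mem_primesUpTo.mp hp).2⟩, rfl⟩ hn

/-- Tail bounds need only be checked on finite sets of primes p > r; the limit over finite partial
sums does the rest. -/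
lemma abs_tsum_sub_sum_primesLe_le {f b : Nat.Primes → ℝ} (hf : Summable f) {r D : ℝ} (hr : 0 ≤ r)
    (hb : ∀ p : Nat.Primes, r < p → |f p| ≤ b p)
    (hD : ∀ T : Finset Nat.Primes, (∀ p ∈ T, r < p) → ∑ p ∈ T, b p ≤ D) :
    |∑' p, f p - ∑ p ∈ primesLe r, f p| ≤ D := by
  have h1 : Tendsto (fun S : Finset Nat.Primes => |∑ p ∈ S, f p - ∑ p ∈ primesLe r, f p|) atTop
      (𝓝 |∑' p, f p - ∑ p ∈ primesLe r, f p|) := (hf.hasSum.sub_const _).abs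
  refine le_of_tendsto h1 ?_
  filter_upwards [eventually_ge_atTop (primesLe r)] with S hS
  have hT : ∀ p ∈ S \ primesLe r, r < p := fun p hp => by
    have := (Finset.mem_sdiff.mp hp).2
    rwa [mem_primesLe hr, not_le] at this
  rw [← Finset.sum_sdiff hS, add_sub_cancel_right]
  exact (Finset.abs_sum_le_sum_abs _ _).trans
    ((Finset.sum_le_sum fun p hp => hb p (hT p hp)).trans (hD _ hT))

/-- The embedding of the primes into `ℕ`. -/
def primesEmb : Nat.Primes ↪ ℕ := ⟨fun p => (p : ℕ), Nat.Primes.coe_nat_injective⟩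

lemma sum_primes_eq_sum_map (T : Finset Nat.Primes) (f : ℕ → ℝ) :
    ∑ p ∈ T.map primesEmb, f p =
      ∑ p ∈ T, f p :=
  Finset.sum_map _ _ _

lemma exists_sum_primes_inv_sq_le : ∃ C : ℝ, 0 ≤ C ∧ ∀ r : ℝ, 2 ≤ r → ∀ T : Finset Nat.Primes,
    (∀ p ∈ T, r < p) → ∑ p ∈ T, 1 / (p : ℝ) ^ 2 ≤ C / (r * Real.log r) := by
  obtain ⟨C, hC⟩ := exists_sum_inv_sq_le
  refine ⟨|C|, abs_nonneg C, fun r hr T hT => ?_⟩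
  have hl : 0 < Real.log r := Real.log_pos (by linarith)
  have := hC r hr (T.map primesEmb) fun p hp => by
    obtain ⟨q, hq, rfl⟩ := Finset.mem_map.mp hp
    exact ⟨q.2, hT q hq⟩
  rw [sum_primes_eq_sum_map T fun p => 1 / (p : ℝ) ^ 2] at this
  exact this.trans (div_le_div_of_nonneg_right (le_abs_self C) (by positivity))

lemma exists_sum_primes_rpow_le : ∃ C : ℝ, 0 ≤ C ∧ ∀ r : ℝ, 2 ≤ r → ∀ T : Finset Nat.Primes,
    (∀ p ∈ T, r < p) → ∑ p ∈ T, (p : ℝ) ^ (-(3 / 2) : ℝ) ≤ C / Real.log r := by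
  obtain ⟨C, hC⟩ := exists_sum_rpow_le
  refine ⟨|C|, abs_nonneg C, fun r hr T hT => ?_⟩
  have hl : 0 < Real.log r := Real.log_pos (by linarith)
  have := hC r hr (T.map primesEmb) fun p hp => by
    obtain ⟨q, hq, rfl⟩ := Finset.mem_map.mp hp
    exact hT q hq
  rw [sum_primes_eq_sum_map T fun p => (p : ℝ) ^ (-(3 / 2) : ℝ)] at this
  exact this.trans (div_le_div_of_nonneg_right (le_abs_self C) hl.le)

lemma summable_primes_inv_sq : Summable fun p : Nat.Primes => 1 / (p : ℝ) ^ 2 :=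
  (Real.summable_one_div_nat_pow.mpr (by norm_num : 1 < 2)).comp_injective Nat.Primes.coe_nat_injective

lemma summable_primes_rpow : Summable fun p : Nat.Primes => (p : ℝ) ^ (-(3 / 2) : ℝ) :=
  (Real.summable_nat_rpow.mpr (by norm_num)).comp_injective Nat.Primes.coe_nat_injective

lemma two_le_coe (p : Nat.Primes) : (2 : ℝ) ≤ p := by exact_mod_cast p.2.two_le

/-! ### Asymptotics of an abstract product of integrals of w exp(z l). -/

/-- The properties of a family of functions `l p`, `w p` on `SU(2)` which give the asymptotic
behaviour of the product over `p` of the integrals of `w p * exp (z * l p)`. -/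
structure LocalData (χ : SU2 → ℝ) (l w : Nat.Primes → SU2 → ℝ) (K c : ℝ) : Prop where
  c_pos : 0 < c
  continuous_χ : Continuous χ
  continuous_l : ∀ p, Continuous (l p)
  continuous_w : ∀ p, Continuous (w p)
  abs_χ_le : ∀ g, |χ g| ≤ K
  integral_χ : ∫ g, χ g ∂haarSU2 = 0
  abs_l_sub_le : ∀ p g, |l p g - χ g / p| ≤ K / (p : ℝ) ^ 2
  abs_l_sub_l_le : ∀ p g h, |l p g - l p h| ≤ K / p * |tr g - tr h|
  le_w : ∀ p g, c ≤ w p g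
  w_le : ∀ p g, w p g ≤ K
  abs_w_sub_one_le : ∀ p g, |w p g - 1| ≤ K * (p : ℝ) ^ (-(1 / 2) : ℝ)
  abs_integral_w_sub_one_le : ∀ p, |∫ g, w p g ∂haarSU2 - 1| ≤ K * (p : ℝ) ^ (-(3 / 2) : ℝ)

/-- The integral of `w p * exp (z * l p)`. -/
noncomputable def localInt (l w : Nat.Primes → SU2 → ℝ) (z : ℝ) (p : Nat.Primes) : ℝ :=
  ∫ g, w p g * Real.exp (z * l p g) ∂haarSU2

lemma abs_exp_sub_one_sub_le {x B : ℝ} (hB : |x| ≤ B) :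
    |Real.exp x - 1 - x| ≤ x ^ 2 * Real.exp B := by
  have h1 : 0 ≤ Real.exp x - 1 - x := by linarith [Real.add_one_le_exp x]
  have h2 : Real.exp x - 1 ≤ x * Real.exp x := by
    have := mul_le_mul_of_nonneg_left (Real.one_sub_le_exp_neg x) (Real.exp_pos x).le
    rw [← Real.exp_add, add_neg_cancel, Real.exp_zero] at this
    linarith
  have hB0 : 1 ≤ Real.exp B := Real.one_le_exp ((abs_nonneg x).trans hB)
  have hxB : Real.exp x ≤ Real.exp B := Real.exp_le_exp.mpr ((le_abs_self x).trans hB)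
  rw [abs_of_nonneg h1]
  calc _ ≤ x * (Real.exp x - 1) := by linarith
    _ ≤ x * (x * Real.exp B) := by
      rcases le_total 0 x with hx | hx
      · exact mul_le_mul_of_nonneg_left (h2.trans (mul_le_mul_of_nonneg_left hxB hx)) hx
      · refine mul_le_mul_of_nonpos_left ?_ hx
        have := mul_le_mul_of_nonpos_left hB0 hx
        linarith
    _ = _ := by ring

lemma le_integral_of_le {f : SU2 → ℝ} (hf : Integrable f haarSU2) {a : ℝ} (h : ∀ g, a ≤ f g) :
    a ≤ ∫ g, f g ∂haarSU2 := by
  have := integral_mono (integrable_const a) hf h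
  rwa [integral_const, probReal_univ, one_smul] at this

lemma integral_le_of_le {f : SU2 → ℝ} (hf : Integrable f haarSU2) {a : ℝ} (h : ∀ g, f g ≤ a) :
    ∫ g, f g ∂haarSU2 ≤ a := by
  have := integral_mono hf (integrable_const a) h
  rwa [integral_const, probReal_univ, one_smul] at this

lemma abs_integral_le_of_abs_le {f : SU2 → ℝ} {a : ℝ} (h : ∀ g, |f g| ≤ a) :
    |∫ g, f g ∂haarSU2| ≤ a := by
  have := norm_integral_le_of_norm_le_const (μ := haarSU2) (f := f) (Eventually.of_forall h)
  rwa [probReal_univ, mul_one] at this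

/-- Used with x a local factor, which is bounded below but not necessarily close to 1. -/
lemma abs_log_le_of_le {c x : ℝ} (hc : 0 < c) (hx : c ≤ x) :
    |Real.log x| ≤ (1 + 1 / c) * |x - 1| := by
  have hx0 : 0 < x := hc.trans_le hx
  have hc' : 0 ≤ 1 / c := by positivity
  have h1 := Real.log_le_sub_one_of_pos hx0
  have h2 := Real.one_sub_inv_le_log_of_pos hx0
  have h3 : -(1 / c * |x - 1|) ≤ 1 - x⁻¹ := by
    have e : 1 - x⁻¹ = -(1 / x * (1 - x)) := by field_simp; ring
    rw [e, neg_le_neg_iff]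
    calc _ ≤ 1 / x * |x - 1| := by
          rw [abs_sub_comm]
          exact mul_le_mul_of_nonneg_left (le_abs_self _) (by positivity)
      _ ≤ _ := mul_le_mul_of_nonneg_right (one_div_le_one_div_of_le hc hx) (abs_nonneg _)
  have h4 := le_abs_self (x - 1)
  have h5 := abs_nonneg (x - 1)
  have h6 : 0 ≤ 1 / c * |x - 1| := by positivity
  rw [abs_le]
  constructor <;> linarith

lemma rpow_neg_half_div {x : ℝ} (hx : 0 < x) :
    x ^ (-(1 / 2) : ℝ) / x = x ^ (-(3 / 2) : ℝ) := by
  rw [← Real.rpow_sub_one hx.ne']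
  norm_num

lemma inv_sq_le_rpow {x : ℝ} (hx : 1 ≤ x) : 1 / x ^ 2 ≤ x ^ (-(3 / 2) : ℝ) := by
  have h : 1 / x ^ 2 = x ^ (-2 : ℝ) := by
    rw [Real.rpow_neg (by linarith), one_div]
    norm_cast
  rw [h]
  exact Real.rpow_le_rpow_of_exponent_le hx (by norm_num)

namespace LocalData

variable {χ : SU2 → ℝ} {l w : Nat.Primes → SU2 → ℝ} {K c : ℝ}

lemma K_pos (H : LocalData χ l w K c) : 0 < K :=
  H.c_pos.trans_le ((H.le_w ⟨2, Nat.prime_two⟩ 1).trans (H.w_le _ _))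

lemma integrable_integrand (H : LocalData χ l w K c) (z : ℝ) (p : Nat.Primes) :
    Integrable (fun g => w p g * Real.exp (z * l p g)) haarSU2 :=
  integrable_of_continuous
    ((H.continuous_w p).mul (Real.continuous_exp.comp (continuous_const.mul (H.continuous_l p))))

lemma abs_l_le (H : LocalData χ l w K c) (p : Nat.Primes) (g : SU2) : |l p g| ≤ 2 * K / p := by
  have hp := two_le_coe p
  have h1 := H.abs_l_sub_le p g
  have h2 : |χ g / p| ≤ K / p := by
    rw [abs_div, abs_of_nonneg (show (0 : ℝ) ≤ p by linarith)]
    exact div_le_div_of_nonneg_right (H.abs_χ_le g) (by linarith)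
  have h3 : K / (p : ℝ) ^ 2 ≤ K / p :=
    div_le_div_of_nonneg_left H.K_pos.le (by linarith) (by nlinarith)
  have h4 := abs_add_le (l p g - χ g / p) (χ g / p)
  rw [sub_add_cancel] at h4
  calc _ ≤ _ := h4
    _ ≤ K / p + K / p := by linarith
    _ = _ := by ring

lemma abs_mul_l_le (H : LocalData χ l w K c) {z : ℝ} {p : Nat.Primes} (hz : |z| ≤ p) (g : SU2) :
    |z * l p g| ≤ 2 * K := by
  have hp := two_le_coe p
  rw [abs_mul]
  calc _ ≤ (p : ℝ) * (2 * K / p) :=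
        mul_le_mul hz (H.abs_l_le p g) (abs_nonneg _) (by linarith)
    _ = _ := by field_simp

lemma localInt_pos (H : LocalData χ l w K c) (z : ℝ) (p : Nat.Primes) : 0 < localInt l w z p := by
  refine lt_of_lt_of_le (mul_pos H.c_pos (Real.exp_pos (-(|z| * (2 * K / p)))))
    (le_integral_of_le (H.integrable_integrand z p) fun g => ?_)
  have h : |z * l p g| ≤ |z| * (2 * K / p) := by
    rw [abs_mul]
    exact mul_le_mul_of_nonneg_left (H.abs_l_le p g) (abs_nonneg z)
  exact mul_le_mul (H.le_w p g) (Real.exp_le_exp.mpr (abs_le.mp h).1) (Real.exp_pos _).le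
    (H.c_pos.le.trans (H.le_w p g))

lemma le_localInt (H : LocalData χ l w K c) {z : ℝ} {p : Nat.Primes} (hz : |z| ≤ p) :
    c * Real.exp (-(2 * K)) ≤ localInt l w z p :=
  le_integral_of_le (H.integrable_integrand z p) fun g =>
    mul_le_mul (H.le_w p g) (Real.exp_le_exp.mpr (abs_le.mp (H.abs_mul_l_le hz g)).1)
      (Real.exp_pos _).le (H.c_pos.le.trans (H.le_w p g))

/-- Three errors are added: the second-order remainder of the exponential, the replacement of l by
χ/p, and the replacement of w by 1 in the linear term. The subtracted term zχ/p has integral 0. -/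
lemma abs_integrand_sub_le (H : LocalData χ l w K c) {z : ℝ} {p : Nat.Primes} (hz : |z| ≤ p)
    (g : SU2) : |w p g * Real.exp (z * l p g) - w p g - z / p * χ g| ≤
      4 * K ^ 3 * Real.exp (2 * K) * (z ^ 2 / (p : ℝ) ^ 2) +
        2 * K ^ 2 * (|z| * (p : ℝ) ^ (-(3 / 2) : ℝ)) := by
  have hp := two_le_coe p
  have hp0 : (0 : ℝ) < p := by linarith
  have hK := H.K_pos
  set u := z * l p g
  have hw : |w p g| ≤ K := by
    rw [abs_of_nonneg (H.c_pos.le.trans (H.le_w p g))]; exact H.w_le p g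
  have h1 : |w p g * (Real.exp u - 1 - u)| ≤
      4 * K ^ 3 * Real.exp (2 * K) * (z ^ 2 / (p : ℝ) ^ 2) := by
    have hu : u ^ 2 ≤ z ^ 2 * (2 * K / p) ^ 2 := by
      rw [mul_pow, ← sq_abs (l p g)]
      exact mul_le_mul_of_nonneg_left
        (pow_le_pow_left₀ (abs_nonneg _) (H.abs_l_le p g) 2) (sq_nonneg z)
    rw [abs_mul]
    calc _ ≤ K * (u ^ 2 * Real.exp (2 * K)) :=
          mul_le_mul hw (abs_exp_sub_one_sub_le (H.abs_mul_l_le hz g)) (abs_nonneg _) hK.le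
      _ ≤ K * (z ^ 2 * (2 * K / p) ^ 2 * Real.exp (2 * K)) := by gcongr
      _ = _ := by field_simp; ring
  have h2 : |w p g * (z * (l p g - χ g / p))| ≤ K ^ 2 * (|z| * (p : ℝ) ^ (-(3 / 2) : ℝ)) := by
    rw [abs_mul, abs_mul]
    calc _ ≤ K * (|z| * (K / (p : ℝ) ^ 2)) := by
          have := H.abs_l_sub_le p g
          gcongr
      _ = K ^ 2 * (|z| * (1 / (p : ℝ) ^ 2)) := by ring
      _ ≤ _ := by
          have := inv_sq_le_rpow (show (1 : ℝ) ≤ p by linarith)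
          gcongr
  have h3 : |(w p g - 1) * (z / p * χ g)| ≤ K ^ 2 * (|z| * (p : ℝ) ^ (-(3 / 2) : ℝ)) := by
    rw [abs_mul, abs_mul, abs_div, abs_of_pos hp0]
    calc _ ≤ K * (p : ℝ) ^ (-(1 / 2) : ℝ) * (|z| / p * K) := by
          have := H.abs_w_sub_one_le p g
          have := H.abs_χ_le g
          gcongr
      _ = K ^ 2 * (|z| * ((p : ℝ) ^ (-(1 / 2) : ℝ) / p)) := by ring
      _ = _ := by rw [rpow_neg_half_div hp0]
  have e : w p g * Real.exp u - w p g - z / p * χ g = w p g * (Real.exp u - 1 - u) +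
      w p g * (z * (l p g - χ g / p)) + (w p g - 1) * (z / p * χ g) := by
    simp only [u]; ring
  rw [e]
  have := abs_add_three (w p g * (Real.exp u - 1 - u)) (w p g * (z * (l p g - χ g / p)))
    ((w p g - 1) * (z / p * χ g))
  linarith

lemma abs_localInt_sub_one_le (H : LocalData χ l w K c) {z : ℝ} {p : Nat.Primes} (hz : |z| ≤ p) :
    |localInt l w z p - 1| ≤ (4 * K ^ 3 * Real.exp (2 * K) + 2 * K ^ 2 + K) *
      ((1 + |z|) * (p : ℝ) ^ (-(3 / 2) : ℝ) + z ^ 2 * (1 / (p : ℝ) ^ 2)) := by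
  have hK := H.K_pos
  have h1 := abs_integral_le_of_abs_le (H.abs_integrand_sub_le hz)
  have iw := integrable_of_continuous (H.continuous_w p)
  have iχ := integrable_of_continuous H.continuous_χ
  have h0 : ∫ g, (w p g * Real.exp (z * l p g) - w p g - z / p * χ g) ∂haarSU2 =
      localInt l w z p - ∫ g, w p g ∂haarSU2 := by
    rw [integral_sub (f := fun g => w p g * Real.exp (z * l p g) - w p g)
      ((H.integrable_integrand z p).sub iw) (iχ.const_mul _),
      integral_sub (H.integrable_integrand z p) iw, integral_const_mul, H.integral_χ, mul_zero,
      sub_zero]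
    rfl
  rw [h0] at h1
  have h2 := H.abs_integral_w_sub_one_le p
  have h3 := abs_add_le (localInt l w z p - ∫ g, w p g ∂haarSU2) (∫ g, w p g ∂haarSU2 - 1)
  rw [sub_add_sub_cancel] at h3
  have h4 : 0 ≤ (p : ℝ) ^ (-(3 / 2) : ℝ) := by positivity
  have h5 : 0 ≤ z ^ 2 * (1 / (p : ℝ) ^ 2) := by positivity
  have h6 : 0 ≤ |z| * (p : ℝ) ^ (-(3 / 2) : ℝ) := by positivity
  have e : z ^ 2 / (p : ℝ) ^ 2 = z ^ 2 * (1 / (p : ℝ) ^ 2) := by ring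
  rw [e] at h1
  have hE : 0 < 4 * K ^ 3 * Real.exp (2 * K) := by positivity
  have hK2 : 0 < K ^ 2 := by positivity
  -- The exponential constant is made opaque, so that the remaining inequality is polynomial.
  generalize 4 * K ^ 3 * Real.exp (2 * K) = E at *
  nlinarith [mul_nonneg hE.le h4, mul_nonneg hE.le h6, mul_nonneg hK2.le h4, mul_nonneg hK2.le h5,
    mul_nonneg hK.le h6, mul_nonneg hK.le h5]

/-- Bound for the logarithm of the local factor when `p` is large in terms of `z`. -/
lemma exists_abs_log_localInt_le (H : LocalData χ l w K c) : ∃ A : ℝ, 0 ≤ A ∧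
    ∀ (z : ℝ) (p : Nat.Primes), |z| ≤ p → |Real.log (localInt l w z p)| ≤
      A * ((1 + |z|) * (p : ℝ) ^ (-(3 / 2) : ℝ) + z ^ 2 * (1 / (p : ℝ) ^ 2)) := by
  have hK := H.K_pos
  have hc' : 0 < c * Real.exp (-(2 * K)) := mul_pos H.c_pos (Real.exp_pos _)
  refine ⟨(1 + 1 / (c * Real.exp (-(2 * K)))) * (4 * K ^ 3 * Real.exp (2 * K) + 2 * K ^ 2 + K),
    by positivity, fun z p hz => ?_⟩
  rw [mul_assoc]
  exact (abs_log_le_of_le hc' (H.le_localInt hz)).trans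
    (mul_le_mul_of_nonneg_left (H.abs_localInt_sub_one_le hz) (by positivity))

lemma summable_log_localInt (H : LocalData χ l w K c) (z : ℝ) :
    Summable fun p => Real.log (localInt l w z p) := by
  obtain ⟨A, hA, hAz⟩ := H.exists_abs_log_localInt_le
  have h1 : Summable fun p : Nat.Primes =>
      A * ((1 + |z|) * (p : ℝ) ^ (-(3 / 2) : ℝ) + z ^ 2 * (1 / (p : ℝ) ^ 2)) :=
    ((summable_primes_rpow.mul_left _).add (summable_primes_inv_sq.mul_left _)).mul_left A
  refine h1.of_norm_bounded_eventually ?_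
  -- The estimate holds only for p ≥ |z|; the finitely many smaller primes do not affect
  -- summability.
  have h2 : ∀ᶠ p in cofinite, p ∉ primesLe |z| := (primesLe |z|).eventually_cofinite_notMem
  filter_upwards [h2] with p hp
  rw [mem_primesLe (abs_nonneg z), not_le] at hp
  exact hAz z p hp.le

/-- Laplace's method at a maximiser g₀. The upper bound is pointwise. The lower bound keeps only the
g with |tr g - tr g₀| ≤ p/r, a set of measure at least (p/27r)⁴. -/
lemma exists_abs_log_localInt_sub_le (H : LocalData χ l w K c) : ∃ A : ℝ, 0 ≤ A ∧
    ∀ (ε r : ℝ) (p : Nat.Primes) (g₀ : SU2), |ε| = 1 → (p : ℝ) ≤ r →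
      (∀ g, ε * l p g ≤ ε * l p g₀) →
      |Real.log (localInt l w (ε * r) p) - r * (ε * l p g₀)| ≤ A * (1 + Real.log (r / p)) := by
  have hK := H.K_pos
  have hc := H.c_pos
  have h27 : 0 ≤ Real.log 27 := Real.log_nonneg (by norm_num)
  refine ⟨|Real.log K| + |Real.log c| + K + 4 * Real.log 27 + 4, by positivity,
    fun ε r p g₀ hε hpr hg₀ => ?_⟩
  have hp := two_le_coe p
  have hp0 : (0 : ℝ) < p := by linarith
  have hr0 : 0 < r := by linarith
  set M := ε * l p g₀
  have hu : Real.log (localInt l w (ε * r) p) ≤ Real.log K + r * M := by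
    rw [← Real.log_exp (r * M), ← Real.log_mul hK.ne' (Real.exp_pos _).ne']
    refine Real.log_le_log (H.localInt_pos _ p)
      (integral_le_of_le (H.integrable_integrand _ p) fun g => ?_)
    refine mul_le_mul (H.w_le p g) (Real.exp_le_exp.mpr ?_) (Real.exp_pos _).le hK.le
    calc _ = r * (ε * l p g) := by ring
      _ ≤ _ := mul_le_mul_of_nonneg_left (hg₀ g) hr0.le
  have hδ0 : 0 < (p : ℝ) / r := by positivity
  have hl : Real.log c + (r * M - K) + 4 * (-Real.log (r / p) - Real.log 27) ≤
      Real.log (localInt l w (ε * r) p) := by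
    -- Markov's inequality at the level c exp(rM - K).
    have h1 : c * Real.exp (r * M - K) * ((p / r) / 27) ^ 4 ≤ localInt l w (ε * r) p := by
      refine le_trans ?_ (mul_meas_ge_le_integral_of_nonneg
        (Eventually.of_forall fun g => mul_nonneg (hc.le.trans (H.le_w p g)) (Real.exp_pos _).le)
        (H.integrable_integrand (ε * r) p) (c * Real.exp (r * M - K)))
      refine mul_le_mul_of_nonneg_left ((le_measure_abs_tr_sub_le g₀ hδ0
        ((div_le_one hr0).mpr hpr)).trans (measureReal_mono fun g hg => ?_)) (by positivity)
      refine mul_le_mul (H.le_w p g) (Real.exp_le_exp.mpr ?_) (Real.exp_pos _).le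
        (hc.le.trans (H.le_w p g))
      -- The Lipschitz constant K/p and the radius p/r multiply to K/r, so the exponent r ε l drops
      -- by at most K.
      have h2 : |ε * l p g₀ - ε * l p g| ≤ K / p * (p / r) := by
        rw [← mul_sub, abs_mul, hε, one_mul, abs_sub_comm]
        exact (H.abs_l_sub_l_le p g g₀).trans (mul_le_mul_of_nonneg_left hg (by positivity))
      have h3 := mul_le_mul_of_nonneg_left ((le_abs_self _).trans h2) hr0.le
      have e1 : r * (K / p * (p / r)) = K := by field_simp
      have e2 : ε * r * l p g = r * (ε * l p g) := by ring
      rw [e1, mul_sub] at h3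
      rw [e2]
      linarith
    have h4 := Real.log_le_log (by positivity) h1
    rw [Real.log_mul (by positivity) (by positivity), Real.log_mul hc.ne' (Real.exp_pos _).ne',
      Real.log_exp, Real.log_pow, Real.log_div hδ0.ne' (by norm_num), ← inv_div r (p : ℝ),
      Real.log_inv] at h4
    push_cast at h4
    exact h4
  have hlog : 0 ≤ Real.log (r / p) := Real.log_nonneg ((one_le_div hp0).mpr hpr)
  have a1 := neg_abs_le (Real.log c)
  have a2 := le_abs_self (Real.log K)
  have a3 := abs_nonneg (Real.log c)
  have a4 := abs_nonneg (Real.log K)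
  have hX : 0 ≤ (|Real.log K| + |Real.log c| + K + 4 * Real.log 27) * Real.log (r / p) := by
    positivity
  rw [abs_le]
  constructor <;> nlinarith

/-- The sum of the logarithms of the local factors is asymptotically the sum of the maxima over
the primes up to `r`. -/
lemma exists_abs_tsum_log_localInt_sub_le (H : LocalData χ l w K c) {ε : ℝ} (hε : |ε| = 1)
    {M : Nat.Primes → ℝ} (hM : ∀ p, ∃ g₀, M p = ε * l p g₀ ∧ ∀ g, ε * l p g ≤ M p) :
    ∃ C : ℝ, ∀ r : ℝ, 2 ≤ r →
      |∑' p, Real.log (localInt l w (ε * r) p) - r * ∑ p ∈ primesLe r, M p| ≤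
        C * (r / Real.log r) := by
  obtain ⟨A, hA, hAz⟩ := H.exists_abs_log_localInt_le
  obtain ⟨B, hB, hBz⟩ := H.exists_abs_log_localInt_sub_le
  obtain ⟨C₁, hC₁, h1⟩ := exists_sum_primes_rpow_le
  obtain ⟨C₂, hC₂, h2⟩ := exists_sum_primes_inv_sq_le
  obtain ⟨C₃, h3⟩ := exists_sum_one_add_log_div_le
  refine ⟨A * (2 * C₁ + C₂) + B * C₃, fun r hr => ?_⟩
  have hr0 : 0 < r := by linarith
  have hl : 0 < Real.log r := Real.log_pos (by linarith)
  have habs : |ε * r| = r := by rw [abs_mul, hε, one_mul, abs_of_pos hr0]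
  have hsq : (ε * r) ^ 2 = r ^ 2 := by rw [← sq_abs, habs]
  -- Over p > r the terms p^(-3/2) carry a factor 1 + r and the terms p⁻² a factor r²; both totals
  -- are O(r / log r).
  have htail := abs_tsum_sub_sum_primesLe_le (H.summable_log_localInt (ε * r)) hr0.le
    (D := A * (2 * C₁ + C₂) * (r / Real.log r))
    (fun p hp => hAz (ε * r) p (habs.le.trans hp.le)) fun T hT => by
      rw [habs, hsq, ← Finset.mul_sum, Finset.sum_add_distrib, ← Finset.mul_sum, ← Finset.mul_sum,
        mul_assoc]
      refine mul_le_mul_of_nonneg_left ?_ hA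
      calc _ ≤ (1 + r) * (C₁ / Real.log r) + r ^ 2 * (C₂ / (r * Real.log r)) := by
            have := h1 r hr T hT
            have := h2 r hr T hT
            gcongr
        _ ≤ (2 * r) * (C₁ / Real.log r) + r ^ 2 * (C₂ / (r * Real.log r)) := by
            gcongr; linarith
        _ = _ := by field_simp
  have hhead : |∑ p ∈ primesLe r, Real.log (localInt l w (ε * r) p) - r * ∑ p ∈ primesLe r, M p| ≤
      B * C₃ * (r / Real.log r) := by
    rw [Finset.mul_sum, ← Finset.sum_sub_distrib, mul_assoc]
    calc _ ≤ ∑ p ∈ primesLe r, |Real.log (localInt l w (ε * r) p) - r * M p| :=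
          Finset.abs_sum_le_sum_abs _ _
      _ ≤ ∑ p ∈ primesLe r, B * (1 + Real.log (r / p)) := by
          refine Finset.sum_le_sum fun p hp => ?_
          obtain ⟨g₀, e, hg₀⟩ := hM p
          rw [e] at hg₀ ⊢
          exact hBz ε r p g₀ hε ((mem_primesLe hr0.le).mp hp) hg₀
      _ = B * ∑ p ∈ primesUpTo ⌊r⌋₊, (1 + Real.log (r / p)) := by
          rw [← Finset.mul_sum, sum_primesLe r fun p => 1 + Real.log (r / p)]
      _ ≤ _ := mul_le_mul_of_nonneg_left (h3 r hr) hB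
  have := abs_add_le
    (∑' p, Real.log (localInt l w (ε * r) p) - ∑ p ∈ primesLe r, Real.log (localInt l w (ε * r) p))
    (∑ p ∈ primesLe r, Real.log (localInt l w (ε * r) p) - r * ∑ p ∈ primesLe r, M p)
  rw [sub_add_sub_cancel] at this
  linarith

end LocalData

end SymPow

namespace SymPow

/-! ### Estimates for the Euler factors -/

lemma sq_one_sub_le_quad {X s : ℝ} (hX : 0 ≤ X) (hs : |s| ≤ 2) : (1 - X) ^ 2 ≤ quad X s := by
  have := mul_le_mul_of_nonneg_right (abs_le.mp hs).2 hX
  rw [quad]; linarith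

lemma quad_le_sq_one_add {X s : ℝ} (hX : 0 ≤ X) (hs : |s| ≤ 2) : quad X s ≤ (1 + X) ^ 2 := by
  have := mul_le_mul_of_nonneg_right (abs_le.mp hs).1 hX
  rw [quad]; linarith

lemma quarter_le_quad {X s : ℝ} (h0 : 0 < X) (h1 : X ≤ 1 / 2) (hs : |s| ≤ 2) :
    1 / 4 ≤ quad X s := by
  have := sq_one_sub_le_quad h0.le hs
  nlinarith

lemma abs_log_sub_log_le {c a b : ℝ} (hc : 0 < c) (ha : c ≤ a) (hb : c ≤ b) :
    |Real.log a - Real.log b| ≤ |a - b| / c := by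
  have key : ∀ x y : ℝ, c ≤ x → c ≤ y → Real.log x - Real.log y ≤ |x - y| / c := by
    intro x y hx hy
    have hx0 := hc.trans_le hx
    have hy0 := hc.trans_le hy
    rw [← Real.log_div hx0.ne' hy0.ne']
    calc _ ≤ x / y - 1 := Real.log_le_sub_one_of_pos (by positivity)
      _ = (x - y) / y := by field_simp
      _ ≤ |x - y| / y := div_le_div_of_nonneg_right (le_abs_self _) hy0.le
      _ ≤ _ := div_le_div_of_nonneg_left (abs_nonneg _) hc hy
  rw [abs_le]
  constructor
  · have := key b a hb ha
    rw [abs_sub_comm] at this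
    linarith
  · exact key a b ha hb

/-- `l X t` is `X χ t + O (X²)`, and is Lipschitz in `t` with constant `O (X)`. -/
structure LogApprox (χ : ℝ → ℝ) (l : ℝ → ℝ → ℝ) (K : ℝ) : Prop where
  abs_χ_le : ∀ t, |t| ≤ 2 → |χ t| ≤ K
  abs_sub_le : ∀ X t, 0 < X → X ≤ 1 / 2 → |t| ≤ 2 → |l X t - χ t * X| ≤ K * X ^ 2
  abs_sub_le_mul : ∀ X t t', 0 < X → X ≤ 1 / 2 → |t| ≤ 2 → |t'| ≤ 2 →
    |l X t - l X t'| ≤ K * X * |t - t'|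

namespace LogApprox

lemma add {χ χ' : ℝ → ℝ} {l l' : ℝ → ℝ → ℝ} {K K' : ℝ} (h : LogApprox χ l K)
    (h' : LogApprox χ' l' K') :
    LogApprox (fun t => χ t + χ' t) (fun X t => l X t + l' X t) (K + K') where
  abs_χ_le t ht := (abs_add_le _ _).trans (add_le_add (h.abs_χ_le t ht) (h'.abs_χ_le t ht))
  abs_sub_le X t h0 h1 ht := by
    have e : l X t + l' X t - (χ t + χ' t) * X = (l X t - χ t * X) + (l' X t - χ' t * X) := by ring
    rw [e, add_mul]
    exact (abs_add_le _ _).trans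
      (add_le_add (h.abs_sub_le X t h0 h1 ht) (h'.abs_sub_le X t h0 h1 ht))
  abs_sub_le_mul X t t' h0 h1 ht ht' := by
    have e : l X t + l' X t - (l X t' + l' X t') = (l X t - l X t') + (l' X t - l' X t') := by ring
    rw [e, add_mul, add_mul]
    exact (abs_add_le _ _).trans
      (add_le_add (h.abs_sub_le_mul X t t' h0 h1 ht ht') (h'.abs_sub_le_mul X t t' h0 h1 ht ht'))

lemma neg_log_one_sub : LogApprox (fun _ => 1) (fun X _ => -Real.log (1 - X)) 2 where
  abs_χ_le t _ := by norm_num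
  abs_sub_le X t h0 h1 _ := by
    have h2 := Real.log_le_sub_one_of_pos (show 0 < 1 - X by linarith)
    have h3 := Real.one_sub_inv_le_log_of_pos (show 0 < 1 - X by linarith)
    have h4 : (1 - X)⁻¹ - 1 - X ≤ 2 * X ^ 2 := by
      have e : (1 - X)⁻¹ - 1 - X = X ^ 2 / (1 - X) := by
        have : 1 - X ≠ 0 := by linarith
        field_simp; ring
      rw [e, div_le_iff₀ (by linarith)]
      nlinarith [sq_nonneg X]
    rw [abs_le]
    constructor <;> nlinarith [sq_nonneg X]
  abs_sub_le_mul X t t' h0 _ _ _ := by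
    rw [sub_self, abs_zero]; positivity

/-- Here s is t, t² - 2 or its iterate. The bound quad ≥ 1/4 gives the Lipschitz constant 4L. -/
lemma neg_log_quad {s : ℝ → ℝ} {L : ℝ} (hL : 0 ≤ L) (hs : ∀ t, |t| ≤ 2 → |s t| ≤ 2)
    (hlip : ∀ t t', |t| ≤ 2 → |t'| ≤ 2 → |s t - s t'| ≤ L * |t - t'|) :
    LogApprox s (fun X t => -Real.log (quad X (s t))) (20 + 4 * L) where
  abs_χ_le t ht := (hs t ht).trans (by linarith)
  abs_sub_le X t h0 h1 ht := by
    obtain ⟨hs1, hs2⟩ := abs_le.mp (hs t ht)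
    have hq := quarter_le_quad h0 h1 (hs t ht)
    have hq0 : 0 < quad X (s t) := by linarith
    have h2 := Real.log_le_sub_one_of_pos hq0
    have h3 := Real.one_sub_inv_le_log_of_pos hq0
    have hX2 := sq_nonneg X
    have hLX : 0 ≤ L * X ^ 2 := by positivity
    have hss : s t ^ 2 ≤ 4 := by nlinarith
    have h4 : (quad X (s t))⁻¹ - 1 - s t * X ≤ 20 * X ^ 2 := by
      have e : (quad X (s t))⁻¹ - 1 - s t * X =
          X ^ 2 * (s t ^ 2 - s t * X - 1) / quad X (s t) := by
        field_simp
        rw [quad]; ring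
      -- The left side is at most 4 + 1 - 1, and the right side is at least 20/4 = 5.
      have h5 : s t ^ 2 - s t * X - 1 ≤ 20 * quad X (s t) := by nlinarith
      rw [e, div_le_iff₀ hq0]
      calc _ ≤ X ^ 2 * (20 * quad X (s t)) := mul_le_mul_of_nonneg_left h5 hX2
        _ = _ := by ring
    rw [abs_le]
    constructor
    · rw [quad] at h2 ⊢; linarith
    · linarith
  abs_sub_le_mul X t t' h0 h1 ht ht' := by
    have h2 := abs_log_sub_log_le (by norm_num) (quarter_le_quad h0 h1 (hs t ht))
      (quarter_le_quad h0 h1 (hs t' ht'))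
    have e : quad X (s t) - quad X (s t') = -(X * (s t - s t')) := by simp only [quad]; ring
    rw [e, abs_neg, abs_mul, abs_of_pos h0] at h2
    have h3 := mul_le_mul_of_nonneg_left (hlip t t' ht ht') h0.le
    have h4 : 0 ≤ X * |t - t'| := by positivity
    rw [neg_sub_neg, abs_sub_comm]
    calc _ ≤ _ := h2
      _ = 4 * (X * |s t - s t'|) := by ring
      _ ≤ 4 * (X * (L * |t - t'|)) := by linarith
      _ ≤ _ := by nlinarith

end LogApprox

lemma abs_sq_sub_two_le {t : ℝ} (ht : |t| ≤ 2) : |t ^ 2 - 2| ≤ 2 := by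
  obtain ⟨h1, h2⟩ := abs_le.mp ht
  rw [abs_le]
  constructor <;> nlinarith

lemma abs_sq_sub_two_sub_le {t t' : ℝ} (ht : |t| ≤ 2) (ht' : |t'| ≤ 2) :
    |(t ^ 2 - 2) - (t' ^ 2 - 2)| ≤ 4 * |t - t'| := by
  have e : (t ^ 2 - 2) - (t' ^ 2 - 2) = (t + t') * (t - t') := by ring
  rw [e, abs_mul]
  exact mul_le_mul_of_nonneg_right ((abs_add_le _ _).trans (by linarith)) (abs_nonneg _)

/-! ### The exponent log D(X, sym^m, ·) for m = 1, 2, 4. -/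

/-- `χ` and `exp (l X ·)` are the character of `sym^m` and `D (X, sym^m, ·)`, as functions of the
trace. -/
structure SymData (m : ℕ) (χ : ℝ → ℝ) (l : ℝ → ℝ → ℝ) (K : ℝ) : Prop extends LogApprox χ l K where
  continuous_χ : Continuous χ
  character_eq : ∀ g, character (sym m) g = (χ (tr g) : ℝ)
  eulerD_eq : ∀ X g, 0 < X → X ≤ 1 / 2 → eulerD (X : ℝ) (sym m) g = (Real.exp (l X (tr g)) : ℝ)
  integral_χ : ∫ g, χ (tr g) ∂haarSU2 = 0

lemma integrable_tr_pow (n : ℕ) : Integrable (fun g => tr g ^ n) haarSU2 :=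
  integrable_of_continuous (continuous_tr.pow n)

lemma symData_one : ∃ χ l K, SymData 1 χ l K := by
  have h1 := LogApprox.neg_log_quad (s := id) zero_le_one (fun t ht => ht)
    fun t t' _ _ => (one_mul |t - t'|).ge
  refine ⟨_, _, _, h1, continuous_id, character_sym_one, fun X g h0 h1 => ?_, integral_tr⟩
  rw [eulerD_sym_one, Real.exp_neg, Real.exp_log]
  · rfl
  · exact lt_of_lt_of_le (by norm_num) (quarter_le_quad h0 h1 (abs_tr_le g))

lemma symData_two : ∃ χ l K, SymData 2 χ l K := by
  have h1 := LogApprox.neg_log_one_sub.add (LogApprox.neg_log_quad (s := fun t => t ^ 2 - 2)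
    (by norm_num : (0 : ℝ) ≤ 4) (fun _ => abs_sq_sub_two_le) fun _ _ => abs_sq_sub_two_sub_le)
  refine ⟨_, _, _, h1, by fun_prop, fun g => ?_, fun X g h0 h1 => ?_, ?_⟩
  · rw [character_sym_two]
    congr 1
    ring
  · have hq := quarter_le_quad h0 h1 (abs_sq_sub_two_le (abs_tr_le g))
    rw [eulerD_sym_two, Real.exp_add, Real.exp_neg, Real.exp_neg, Real.exp_log (by linarith),
      Real.exp_log (by linarith), mul_inv]
  · have e : ∀ g : SU2, 1 + (tr g ^ 2 - 2) = tr g ^ 2 - 1 := fun g => by ring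
    simp only [e]
    rw [integral_sub (integrable_tr_pow 2) (integrable_const _), integral_tr_sq]
    simp

lemma symData_four : ∃ χ l K, SymData 4 χ l K := by
  have h1 := (LogApprox.neg_log_one_sub.add (LogApprox.neg_log_quad (s := fun t => t ^ 2 - 2)
    (by norm_num : (0 : ℝ) ≤ 4) (fun _ => abs_sq_sub_two_le)
      fun _ _ => abs_sq_sub_two_sub_le)).add
    (LogApprox.neg_log_quad (s := fun t => (t ^ 2 - 2) ^ 2 - 2) (by norm_num : (0 : ℝ) ≤ 16)
      (fun t ht => abs_sq_sub_two_le (abs_sq_sub_two_le ht)) fun t t' ht ht' => by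
        have h2 := abs_sq_sub_two_sub_le (abs_sq_sub_two_le ht) (abs_sq_sub_two_le ht')
        have h3 := abs_sq_sub_two_sub_le ht ht'
        linarith)
  refine ⟨_, _, _, h1, by fun_prop, fun g => ?_, fun X g h0 h1 => ?_, ?_⟩
  · rw [character_sym_four]
    congr 1
    ring
  · have hq := quarter_le_quad h0 h1 (abs_sq_sub_two_le (abs_tr_le g))
    have hq' := quarter_le_quad h0 h1 (abs_sq_sub_two_le (abs_sq_sub_two_le (abs_tr_le g)))
    rw [eulerD_sym_four, Real.exp_add, Real.exp_add, Real.exp_neg, Real.exp_neg, Real.exp_neg,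
      Real.exp_log (by linarith), Real.exp_log (by linarith), Real.exp_log (by linarith), mul_inv,
      mul_inv]
  · have e : ∀ g : SU2, 1 + (tr g ^ 2 - 2) + ((tr g ^ 2 - 2) ^ 2 - 2) =
        tr g ^ 4 - 3 * tr g ^ 2 + 1 := fun g => by ring
    simp only [e]
    rw [integral_add (f := fun g => tr g ^ 4 - 3 * tr g ^ 2)
      ((integrable_tr_pow 4).sub ((integrable_tr_pow 2).const_mul 3)) (integrable_const _),
      integral_sub (integrable_tr_pow 4) ((integrable_tr_pow 2).const_mul 3), integral_const_mul,
      integral_tr_sq, integral_tr_pow_four]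
    simp
    norm_num

namespace SymData

variable {m : ℕ} {χ : ℝ → ℝ} {l : ℝ → ℝ → ℝ} {K : ℝ}

lemma K_nonneg (H : SymData m χ l K) : 0 ≤ K :=
  (abs_nonneg _).trans (H.abs_χ_le 0 (by norm_num))

lemma continuous_l (H : SymData m χ l K) {X : ℝ} (h0 : 0 < X) (h1 : X ≤ 1 / 2) :
    Continuous fun g => l X (tr g) := by
  rw [continuous_iff_continuousAt]
  intro g₀
  rw [ContinuousAt, tendsto_iff_norm_sub_tendsto_zero]
  have h2 : Tendsto (fun g => K * X * |tr g - tr g₀|) (𝓝 g₀) (𝓝 0) := by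
    have : Continuous fun g => K * X * |tr g - tr g₀| :=
      continuous_const.mul (continuous_tr.sub continuous_const).abs
    have := this.tendsto g₀
    simpa using this
  exact squeeze_zero (fun _ => norm_nonneg _)
    (fun g => H.abs_sub_le_mul X _ _ h0 h1 (abs_tr_le g) (abs_tr_le g₀)) h2

end SymData

/-! ### The weights coming from st at 1/2 and sym² at 1. -/

/-- `w p` is the first factor in the integrand of the local factor at `p`. -/
structure WeightData {n : ℕ} (s : ℂ) (ρ : SU2 →* Matrix (Fin n) (Fin n) ℂ)
    (w : Nat.Primes → SU2 → ℝ) (K c : ℝ) : Prop where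
  eulerD_eq : ∀ (p : Nat.Primes) g, eulerD ((p : ℂ) ^ (-s)) ρ g = (w p g : ℝ)
  c_pos : 0 < c
  continuous_w : ∀ p, Continuous (w p)
  le_w : ∀ p g, c ≤ w p g
  w_le : ∀ p g, w p g ≤ K
  abs_w_sub_one_le : ∀ p g, |w p g - 1| ≤ K * (p : ℝ) ^ (-(1 / 2) : ℝ)
  abs_integral_w_sub_one_le : ∀ p, |∫ g, w p g ∂haarSU2 - 1| ≤ K * (p : ℝ) ^ (-(3 / 2) : ℝ)

lemma inv_coe_pos (p : Nat.Primes) : (0 : ℝ) < (p : ℝ)⁻¹ :=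
  inv_pos.mpr (by linarith [two_le_coe p])

lemma inv_coe_le_half (p : Nat.Primes) : (p : ℝ)⁻¹ ≤ 1 / 2 := by
  rw [← one_div]
  exact one_div_le_one_div_of_le (by norm_num) (two_le_coe p)

lemma abs_integral_sub_add_le {f h : SU2 → ℝ} {a B : ℝ} (hf : Integrable f haarSU2)
    (hh : Integrable h haarSU2) (hB : ∀ g, |f g - (a + h g)| ≤ B) :
    |∫ g, f g ∂haarSU2 - (a + ∫ g, h g ∂haarSU2)| ≤ B := by
  have h1 := abs_integral_le_of_abs_le hB
  have hi : Integrable (fun g => a + h g) haarSU2 := (integrable_const a).add hh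
  rwa [integral_sub hf hi, integral_add (integrable_const a) hh, integral_const, probReal_univ,
    one_smul] at h1

/-- Geometric series for 1/(1 - y) with y = tX - X². The range X ≤ 3/4 covers X = p^(-1/2) for every
prime. The part depending on t is grouped for integration against the moments of the trace. -/
lemma abs_inv_quad_sub_le {X t : ℝ} (h0 : 0 < X) (h1 : X ≤ 3 / 4) (ht : |t| ≤ 2) :
    |(quad X t)⁻¹ - 1| ≤ 48 * X ∧
      |(quad X t)⁻¹ - (1 - X ^ 2 + (t * X + t ^ 2 * X ^ 2))| ≤ 500 * X ^ 3 := by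
  have hq := sq_one_sub_le_quad h0.le ht
  have hq1 : 1 / 16 ≤ quad X t := by nlinarith
  have hq0 : 0 < quad X t := by linarith
  have hinv : (quad X t)⁻¹ ≤ 16 := by
    rw [inv_le_comm₀ hq0 (by norm_num)]; linarith
  have hinv0 : 0 < (quad X t)⁻¹ := inv_pos.mpr hq0
  set y := t * X - X ^ 2 with hy
  have hy1 : |y| ≤ 3 * X := by
    obtain ⟨a, b⟩ := abs_le.mp ht
    rw [abs_le, hy]
    constructor <;> nlinarith
  have hqy : quad X t = 1 - y := by rw [quad, hy]; ring
  constructor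
  · have e : (quad X t)⁻¹ - 1 = y * (quad X t)⁻¹ := by
      field_simp; rw [hqy]; ring
    rw [e, abs_mul, abs_of_pos hinv0]
    calc _ ≤ 3 * X * 16 := mul_le_mul hy1 hinv hinv0.le (by positivity)
      _ = _ := by ring
  · have e : (quad X t)⁻¹ - (1 - X ^ 2 + (t * X + t ^ 2 * X ^ 2)) =
        y ^ 3 * (quad X t)⁻¹ + X ^ 3 * (X - 2 * t) := by
      have e1 : (quad X t)⁻¹ = 1 + y + y ^ 2 + y ^ 3 * (quad X t)⁻¹ := by
        field_simp; rw [hqy]; ring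
      linear_combination e1 + (1 + y + t * X - X ^ 2) * hy
    rw [e]
    have h2 : |y ^ 3 * (quad X t)⁻¹| ≤ 432 * X ^ 3 := by
      rw [abs_mul, abs_pow, abs_of_pos hinv0]
      calc _ ≤ (3 * X) ^ 3 * 16 :=
            mul_le_mul (pow_le_pow_left₀ (abs_nonneg _) hy1 3) hinv hinv0.le (by positivity)
        _ = _ := by ring
    have h3 : |X ^ 3 * (X - 2 * t)| ≤ X ^ 3 * 5 := by
      rw [abs_mul, abs_of_pos (show 0 < X ^ 3 by positivity)]
      refine mul_le_mul_of_nonneg_left ?_ (by positivity)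
      obtain ⟨a, b⟩ := abs_le.mp ht
      rw [abs_le]
      constructor <;> linarith
    have h4 : 0 < X ^ 3 := by positivity
    exact (abs_add_le _ _).trans (by linarith)

lemma weightData_st : ∃ w K c, WeightData (1 / 2) st w K c := by
  have hX : ∀ p : Nat.Primes, 0 < (p : ℝ) ^ (-(1 / 2) : ℝ) ∧ (p : ℝ) ^ (-(1 / 2) : ℝ) ≤ 3 / 4 ∧
      ((p : ℝ) ^ (-(1 / 2) : ℝ)) ^ 3 = (p : ℝ) ^ (-(3 / 2) : ℝ) := by
    intro p
    have hp := two_le_coe p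
    have hp0 : (0 : ℝ) < p := by linarith
    have h0 : 0 < (p : ℝ) ^ (-(1 / 2) : ℝ) := by positivity
    refine ⟨h0, ?_, ?_⟩
    · have h2 : ((p : ℝ) ^ (-(1 / 2) : ℝ)) ^ 2 = (p : ℝ)⁻¹ := by
        rw [← Real.rpow_natCast, ← Real.rpow_mul hp0.le, ← Real.rpow_neg_one]
        norm_num
      have := inv_coe_le_half p
      nlinarith
    · rw [← Real.rpow_natCast, ← Real.rpow_mul hp0.le]
      norm_num
  -- The lower bound 1/4 comes from quad ≤ (1 + X)² ≤ 4; the constant 500 is that of the cubic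
  -- remainder and exceeds the other constants, 16 and 48.
  refine ⟨fun p g => (quad ((p : ℝ) ^ (-(1 / 2) : ℝ)) (tr g))⁻¹, 500, 1 / 4, ?_⟩
  have hq : ∀ (p : Nat.Primes) g, 1 / 16 ≤ quad ((p : ℝ) ^ (-(1 / 2) : ℝ)) (tr g) ∧
      quad ((p : ℝ) ^ (-(1 / 2) : ℝ)) (tr g) ≤ 4 := by
    intro p g
    obtain ⟨h0, h1, -⟩ := hX p
    have h2 := sq_one_sub_le_quad h0.le (abs_tr_le g)
    have h3 := quad_le_sq_one_add h0.le (abs_tr_le g)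
    constructor <;> nlinarith
  have hcont : ∀ p : Nat.Primes, Continuous fun g => (quad ((p : ℝ) ^ (-(1 / 2) : ℝ)) (tr g))⁻¹ := by
    intro p
    refine Continuous.inv₀ ?_ fun g => ?_
    · unfold quad
      exact ((continuous_const.sub (continuous_tr.mul continuous_const)).add continuous_const)
    · linarith [(hq p g).1]
  refine ⟨fun p g => ?_, by norm_num, hcont, fun p g => ?_, fun p g => ?_, fun p g => ?_,
    fun p => ?_⟩
  · rw [← eulerD_st]
    congr 1
    rw [Complex.ofReal_cpow (by linarith [two_le_coe p])]
    push_cast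
    rfl
  · rw [one_div]
    exact inv_anti₀ (by linarith [(hq p g).1]) (hq p g).2
  · have := inv_anti₀ (by norm_num) (hq p g).1
    norm_num at this ⊢
    linarith
  · obtain ⟨h0, h1, -⟩ := hX p
    exact (abs_inv_quad_sub_le h0 h1 (abs_tr_le g)).1.trans (by linarith)
  · obtain ⟨h0, h1, h3⟩ := hX p
    rw [← h3]
    set X := (p : ℝ) ^ (-(1 / 2) : ℝ)
    have i1 : Integrable (fun g => tr g * X) haarSU2 :=
      (integrable_of_continuous continuous_tr).mul_const X
    have i2 := (integrable_tr_pow 2).mul_const (X ^ 2)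
    have h4 := abs_integral_sub_add_le (integrable_of_continuous (hcont p)) (i1.add i2)
      fun g => (abs_inv_quad_sub_le h0 h1 (abs_tr_le g)).2
    -- With moments 0 and 1, the X term vanishes and the X² terms cancel, leaving O(X³) =
    -- O(p^(-3/2)).
    rw [integral_add' i1 i2, integral_mul_const, integral_mul_const, integral_tr,
      integral_tr_sq] at h4
    convert h4 using 3
    ring

/-- The weight is exp(l) for the sym² data, so it equals 1 + χ/p + O(p⁻²), and ∫ χ = 0 removes the
middle term. -/
lemma weightData_sym_two : ∃ w K c, WeightData 1 (sym 2) w K c := by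
  obtain ⟨χ, l, K, H⟩ := symData_two
  have hK := H.K_nonneg
  set E := 4 * K ^ 2 * Real.exp K with hE
  have hE0 : 0 ≤ E := by positivity
  have hl : ∀ (p : Nat.Primes) g, |l (p : ℝ)⁻¹ (tr g)| ≤ 2 * K * (p : ℝ)⁻¹ := by
    intro p g
    have h0 := inv_coe_pos p
    have h1 := inv_coe_le_half p
    have h2 := H.abs_sub_le _ _ h0 h1 (abs_tr_le g)
    have h3 : |χ (tr g) * (p : ℝ)⁻¹| ≤ K * (p : ℝ)⁻¹ := by
      rw [abs_mul, abs_of_pos h0]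
      exact mul_le_mul_of_nonneg_right (H.abs_χ_le _ (abs_tr_le g)) h0.le
    have h4 : K * ((p : ℝ)⁻¹) ^ 2 ≤ K * (p : ℝ)⁻¹ :=
      mul_le_mul_of_nonneg_left (by nlinarith) hK
    have h5 := abs_add_le (l (p : ℝ)⁻¹ (tr g) - χ (tr g) * (p : ℝ)⁻¹) (χ (tr g) * (p : ℝ)⁻¹)
    rw [sub_add_cancel] at h5
    linarith
  have hlK : ∀ (p : Nat.Primes) g, |l (p : ℝ)⁻¹ (tr g)| ≤ K := fun p g =>
    (hl p g).trans (by nlinarith [inv_coe_le_half p])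
  have hexp : ∀ (p : Nat.Primes) g, |Real.exp (l (p : ℝ)⁻¹ (tr g)) - 1 - l (p : ℝ)⁻¹ (tr g)| ≤
      E * ((p : ℝ)⁻¹) ^ 2 := by
    intro p g
    refine (abs_exp_sub_one_sub_le (hlK p g)).trans ?_
    have := pow_le_pow_left₀ (abs_nonneg _) (hl p g) 2
    rw [sq_abs] at this
    calc _ ≤ (2 * K * (p : ℝ)⁻¹) ^ 2 * Real.exp K :=
          mul_le_mul_of_nonneg_right this (Real.exp_pos _).le
      _ = _ := by rw [hE]; ring
  have hcont : ∀ p : Nat.Primes, Continuous fun g => Real.exp (l (p : ℝ)⁻¹ (tr g)) := fun p =>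
    Real.continuous_exp.comp (H.continuous_l (inv_coe_pos p) (inv_coe_le_half p))
  refine ⟨fun p g => Real.exp (l (p : ℝ)⁻¹ (tr g)), 2 * K + E + Real.exp K, Real.exp (-K),
    fun p g => ?_, Real.exp_pos _, hcont, fun p g => Real.exp_le_exp.mpr (abs_le.mp (hlK p g)).1,
    fun p g => ?_, fun p g => ?_, fun p => ?_⟩
  · rw [← H.eulerD_eq _ g (inv_coe_pos p) (inv_coe_le_half p)]
    congr 1
    rw [Complex.cpow_neg_one]
    push_cast
    rfl
  · have := Real.exp_le_exp.mpr (abs_le.mp (hlK p g)).2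
    linarith
  · have h0 := inv_coe_pos p
    have h1 := inv_coe_le_half p
    have h2 := abs_add_le (Real.exp (l (p : ℝ)⁻¹ (tr g)) - 1 - l (p : ℝ)⁻¹ (tr g))
      (l (p : ℝ)⁻¹ (tr g))
    rw [sub_add_cancel] at h2
    have h3 : E * ((p : ℝ)⁻¹) ^ 2 ≤ E * (p : ℝ)⁻¹ :=
      mul_le_mul_of_nonneg_left (by nlinarith) hE0
    have h4 : (p : ℝ)⁻¹ ≤ (p : ℝ) ^ (-(1 / 2) : ℝ) := by
      rw [← Real.rpow_neg_one]
      exact Real.rpow_le_rpow_of_exponent_le (by linarith [two_le_coe p]) (by norm_num)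
    calc _ ≤ (2 * K + E) * (p : ℝ)⁻¹ := by linarith [hexp p g, hl p g]
      _ ≤ (2 * K + E + Real.exp K) * (p : ℝ)⁻¹ :=
        mul_le_mul_of_nonneg_right (by linarith [Real.exp_pos K]) h0.le
      _ ≤ _ := mul_le_mul_of_nonneg_left h4 (by positivity)
  · have h4 : ∀ g, |Real.exp (l (p : ℝ)⁻¹ (tr g)) - (1 + χ (tr g) * (p : ℝ)⁻¹)| ≤
        (K + E) * ((p : ℝ)⁻¹) ^ 2 := by
      intro g
      have h2 := H.abs_sub_le _ _ (inv_coe_pos p) (inv_coe_le_half p) (abs_tr_le g)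
      have h3 := abs_add_le (Real.exp (l (p : ℝ)⁻¹ (tr g)) - 1 - l (p : ℝ)⁻¹ (tr g))
        (l (p : ℝ)⁻¹ (tr g) - χ (tr g) * (p : ℝ)⁻¹)
      have e : Real.exp (l (p : ℝ)⁻¹ (tr g)) - (1 + χ (tr g) * (p : ℝ)⁻¹) =
        (Real.exp (l (p : ℝ)⁻¹ (tr g)) - 1 - l (p : ℝ)⁻¹ (tr g)) +
          (l (p : ℝ)⁻¹ (tr g) - χ (tr g) * (p : ℝ)⁻¹) := by ring
      rw [e]
      linarith [hexp p g]
    have iχ : Integrable (fun g => χ (tr g) * (p : ℝ)⁻¹) haarSU2 :=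
      (integrable_of_continuous (H.continuous_χ.comp continuous_tr)).mul_const _
    have h5 := abs_integral_sub_add_le (integrable_of_continuous (hcont p)) iχ h4
    rw [integral_mul_const, H.integral_χ, zero_mul, add_zero] at h5
    refine h5.trans ?_
    have h6 := inv_sq_le_rpow (show (1 : ℝ) ≤ p by linarith [two_le_coe p])
    rw [one_div, ← inv_pow] at h6
    exact mul_le_mul (by linarith [Real.exp_pos K]) h6 (by positivity) (by positivity)

end SymPow

namespace SymPow

/-! ### The Euler products -/

/-- The data attached to a pair of representations satisfy the hypotheses of the asymptotic
formula. -/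
lemma SymData.localData {m n : ℕ} {χ : ℝ → ℝ} {l : ℝ → ℝ → ℝ} {K K' c : ℝ} {s : ℂ}
    {ρ : SU2 →* Matrix (Fin n) (Fin n) ℂ} {w : Nat.Primes → SU2 → ℝ} (H : SymData m χ l K)
    (W : WeightData s ρ w K' c) :
    LocalData (fun g => χ (tr g)) (fun p g => l (p : ℝ)⁻¹ (tr g)) w (K + K') c := by
  have hK := H.K_nonneg
  have hK' : 0 ≤ K' :=
    W.c_pos.le.trans ((W.le_w ⟨2, Nat.prime_two⟩ 1).trans (W.w_le _ _))
  refine ⟨W.c_pos, H.continuous_χ.comp continuous_tr,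
    fun p => H.continuous_l (inv_coe_pos p) (inv_coe_le_half p), W.continuous_w,
    fun g => (H.abs_χ_le _ (abs_tr_le g)).trans (by linarith), H.integral_χ, fun p g => ?_,
    fun p g h => ?_, W.le_w, fun p g => (W.w_le p g).trans (by linarith), fun p g => ?_,
    fun p => ?_⟩
  · have h := H.abs_sub_le _ _ (inv_coe_pos p) (inv_coe_le_half p) (abs_tr_le g)
    rw [div_eq_mul_inv, div_eq_mul_inv, ← inv_pow]
    exact h.trans (mul_le_mul_of_nonneg_right (by linarith) (by positivity))
  · have h' := H.abs_sub_le_mul _ _ _ (inv_coe_pos p) (inv_coe_le_half p) (abs_tr_le g) (abs_tr_le h)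
    rw [div_eq_mul_inv]
    refine h'.trans (mul_le_mul_of_nonneg_right ?_ (abs_nonneg _))
    exact mul_le_mul_of_nonneg_right (by linarith) (inv_coe_pos p).le
  · exact (W.abs_w_sub_one_le p g).trans
      (mul_le_mul_of_nonneg_right (by linarith) (by positivity))
  · exact (W.abs_integral_w_sub_one_le p).trans
      (mul_le_mul_of_nonneg_right (by linarith) (by positivity))

section

variable {m n : ℕ} {χ : ℝ → ℝ} {l : ℝ → ℝ → ℝ} {K K' c : ℝ} {s : ℂ}
  {ρ : SU2 →* Matrix (Fin n) (Fin n) ℂ} {w : Nat.Primes → SU2 → ℝ}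

lemma SymData.eulerD_inv_eq (H : SymData m χ l K) (p : Nat.Primes) (g : SU2) :
    eulerD ((p : ℂ)⁻¹) (sym m) g = (Real.exp (l (p : ℝ)⁻¹ (tr g)) : ℝ) := by
  rw [← H.eulerD_eq _ g (inv_coe_pos p) (inv_coe_le_half p)]
  congr 1
  push_cast
  rfl

/-- The base of the complex power is a positive real, so the power with real exponent is a real
exponential. -/
lemma SymData.localFactor_eq (H : SymData m χ l K) (W : WeightData s ρ w K' c) (z : ℝ)
    (p : Nat.Primes) :
    localFactor s 1 ρ (sym m) z p = (localInt (fun p g => l (p : ℝ)⁻¹ (tr g)) w z p : ℝ) := by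
  rw [localFactor, localInt]
  refine Eq.trans ?_ (integral_ofReal (𝕜 := ℂ))
  refine integral_congr_ae (Eventually.of_forall fun g => ?_)
  simp only
  rw [W.eulerD_eq, Complex.cpow_neg_one, H.eulerD_inv_eq, ← Complex.ofReal_cpow (Real.exp_pos _).le,
    ← Complex.ofReal_mul, ← Real.exp_mul, mul_comm z]
  rfl

lemma SymData.hasProd_localFactor (H : SymData m χ l K) (W : WeightData s ρ w K' c) (z : ℝ) :
    HasProd (localFactor s 1 ρ (sym m) z)
      (Real.exp (∑' p, Real.log (localInt (fun p g => l (p : ℝ)⁻¹ (tr g)) w z p)) : ℝ) := by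
  have L := H.localData W
  have h := Real.hasProd_of_hasSum_log (L.localInt_pos z) (L.summable_log_localInt z).hasSum
  have h2 := h.map Complex.ofRealHom Complex.continuous_ofReal
  have e : localFactor s 1 ρ (sym m) z =
      Complex.ofRealHom ∘ localInt (fun p g => l (p : ℝ)⁻¹ (tr g)) w z :=
    funext fun p => H.localFactor_eq W z p
  rw [e]
  exact h2

lemma SymData.twistedL_eq (H : SymData m χ l K) (W : WeightData s ρ w K' c) (z : ℝ) :
    twistedL s 1 ρ (sym m) z =
      (Real.exp (∑' p, Real.log (localInt (fun p g => l (p : ℝ)⁻¹ (tr g)) w z p)) : ℝ) :=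
  (H.hasProd_localFactor W z).tprod_eq

/-! ### Maxima over SU(2) and the main term. -/

lemma SymData.exists_symSup_eq (H : SymData m χ l K) (ε : ℝ) :
    ∃ g₀, symSup m ε = ε * χ (tr g₀) ∧ ∀ g, ε * χ (tr g) ≤ symSup m ε := by
  have hc : Continuous fun g => ε * χ (tr g) :=
    continuous_const.mul (H.continuous_χ.comp continuous_tr)
  obtain ⟨g₀, -, hg₀⟩ := isCompact_univ.exists_isMaxOn Set.univ_nonempty hc.continuousOn
  have hmax : ∀ g, ε * χ (tr g) ≤ ε * χ (tr g₀) := fun g => hg₀ (Set.mem_univ g)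
  have e : symSup m ε = ε * χ (tr g₀) := by
    have h1 : symSup m ε = ⨆ g, ε * χ (tr g) := by
      rw [symSup]
      simp only [H.character_eq, Complex.ofReal_re]
    rw [h1]
    exact IsGreatest.csSup_eq ⟨⟨g₀, rfl⟩, by rintro _ ⟨g, rfl⟩; exact hmax g⟩
  exact ⟨g₀, e, e ▸ hmax⟩

/-- The maximum over `g` of `ε * log D (p⁻¹, sym^m, g)`. -/
noncomputable def logDSup (m : ℕ) (ε : ℝ) (p : Nat.Primes) : ℝ :=
  ε * Real.log (ε * eulerDSup m ε p)

/-- Since exp is increasing, ε l and ε exp(l) have the same maximisers for either sign. At such a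
point ε · ε = 1 cancels the inner sign before the logarithm is taken. -/
lemma SymData.exists_logDSup_eq (H : SymData m χ l K) {ε : ℝ} (hε : ε = 1 ∨ ε = -1)
    (p : Nat.Primes) : ∃ g₀, logDSup m ε p = ε * l (p : ℝ)⁻¹ (tr g₀) ∧
      ∀ g, ε * l (p : ℝ)⁻¹ (tr g) ≤ logDSup m ε p := by
  have hc : Continuous fun g => ε * l (p : ℝ)⁻¹ (tr g) :=
    continuous_const.mul (H.continuous_l (inv_coe_pos p) (inv_coe_le_half p))
  obtain ⟨g₀, -, hg₀⟩ := isCompact_univ.exists_isMaxOn Set.univ_nonempty hc.continuousOn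
  have hmax : ∀ g, ε * l (p : ℝ)⁻¹ (tr g) ≤ ε * l (p : ℝ)⁻¹ (tr g₀) :=
    fun g => hg₀ (Set.mem_univ g)
  have hεε : ε * ε = 1 := by rcases hε with rfl | rfl <;> norm_num
  have hexp : ∀ g, ε * Real.exp (l (p : ℝ)⁻¹ (tr g)) ≤ ε * Real.exp (l (p : ℝ)⁻¹ (tr g₀)) := by
    intro g
    have h := hmax g
    rcases hε with rfl | rfl
    · rw [one_mul, one_mul] at h ⊢
      exact Real.exp_le_exp.mpr h
    · rw [neg_one_mul, neg_one_mul, neg_le_neg_iff] at h ⊢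
      exact Real.exp_le_exp.mpr h
  have e1 : eulerDSup m ε p = ε * Real.exp (l (p : ℝ)⁻¹ (tr g₀)) := by
    have h1 : eulerDSup m ε p = ⨆ g, ε * Real.exp (l (p : ℝ)⁻¹ (tr g)) := by
      rw [eulerDSup]
      simp only [H.eulerD_inv_eq, Complex.ofReal_re]
    rw [h1]
    exact IsGreatest.csSup_eq ⟨⟨g₀, rfl⟩, by rintro _ ⟨g, rfl⟩; exact hexp g⟩
  have e : logDSup m ε p = ε * l (p : ℝ)⁻¹ (tr g₀) := by
    rw [logDSup, e1, ← mul_assoc, hεε, one_mul, Real.log_exp]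
  exact ⟨g₀, e, e ▸ hmax⟩

/-- Two functions at uniform distance K/p² have maxima at distance at most K/p²: each is compared at
the other's maximiser. -/
lemma SymData.abs_symOneTerm_le (H : SymData m χ l K) {ε : ℝ} (hε : ε = 1 ∨ ε = -1)
    (p : Nat.Primes) : |symOneTerm m ε p| ≤ K * (1 / (p : ℝ) ^ 2) := by
  obtain ⟨g₀, e₀, h₀⟩ := H.exists_logDSup_eq hε p
  obtain ⟨g₁, e₁, h₁⟩ := H.exists_symSup_eq ε
  have hεabs : |ε| = 1 := by rcases hε with rfl | rfl <;> norm_num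
  have hp := inv_coe_pos p
  have key : ∀ g, |ε * l (p : ℝ)⁻¹ (tr g) - ε * χ (tr g) * (p : ℝ)⁻¹| ≤ K * (1 / (p : ℝ) ^ 2) := by
    intro g
    rw [mul_assoc, ← mul_sub, abs_mul, hεabs, one_mul, one_div, ← inv_pow]
    exact H.abs_sub_le _ _ hp (inv_coe_le_half p) (abs_tr_le g)
  have k0 := abs_le.mp (key g₀)
  have k1 := abs_le.mp (key g₁)
  have a0 := mul_le_mul_of_nonneg_right (h₁ g₀) hp.le
  have a1 := h₀ g₁
  rw [← e₁] at k1
  rw [← e₀] at k0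
  change |logDSup m ε p - symSup m ε / (p : ℝ)| ≤ _
  rw [div_eq_mul_inv, abs_le]
  constructor <;> linarith

lemma SymData.summable_symOneTerm (H : SymData m χ l K) {ε : ℝ} (hε : ε = 1 ∨ ε = -1) :
    Summable (symOneTerm m ε) :=
  (summable_primes_inv_sq.mul_left K).of_norm_bounded fun p => H.abs_symOneTerm_le hε p

lemma sum_logDSup_eq (m : ℕ) (ε r : ℝ) : ∑ p ∈ primesLe r, logDSup m ε p =
    symSup m ε * primeRecipSum r + ∑ p ∈ primesLe r, symOneTerm m ε p := by
  rw [primeRecipSum_eq, ← sum_primesLe r fun p => 1 / (p : ℝ), Finset.mul_sum,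
    ← Finset.sum_add_distrib]
  refine Finset.sum_congr rfl fun p _ => ?_
  rw [symOneTerm, logDSup]
  ring

/-- The sum of the maxima over the primes up to `r` is the main term. -/
lemma SymData.exists_abs_sum_logDSup_sub_le (H : SymData m χ l K) {ε : ℝ} (hε : ε = 1 ∨ ε = -1) :
    ∃ C : ℝ, ∀ r : ℝ, 2 ≤ r →
      |r * ∑ p ∈ primesLe r, logDSup m ε p - mainTerm m ε r| ≤ C * (r / Real.log r) := by
  obtain ⟨C, hC⟩ := exists_abs_primeRecipSum_sub_gammaStar_le
  obtain ⟨C₂, hC₂, h2⟩ := exists_sum_primes_inv_sq_le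
  refine ⟨|symSup m ε| * C + K * C₂, fun r hr => ?_⟩
  have hr0 : 0 < r := by linarith
  have hl : 0 < Real.log r := Real.log_pos (by linarith)
  have htail := abs_tsum_sub_sum_primesLe_le (H.summable_symOneTerm hε) hr0.le
    (D := K * (C₂ / (r * Real.log r))) (fun p _ => H.abs_symOneTerm_le hε p) fun T hT => by
      rw [← Finset.mul_sum]
      exact mul_le_mul_of_nonneg_left (h2 r hr T hT) H.K_nonneg
  -- The error splits into that of Mertens' theorem and the tail over p > r of the series in the
  -- constant.
  have e : r * ∑ p ∈ primesLe r, logDSup m ε p - mainTerm m ε r =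
      r * symSup m ε * (primeRecipSum r - (Real.log (Real.log r) + gammaStar)) -
        r * (∑' p, symOneTerm m ε p - ∑ p ∈ primesLe r, symOneTerm m ε p) := by
    rw [sum_logDSup_eq, mainTerm, symOne]
    ring
  rw [e]
  refine (abs_sub _ _).trans ?_
  rw [abs_mul, abs_mul, abs_mul, abs_of_pos hr0]
  have h3 : r * |symSup m ε| * |primeRecipSum r - (Real.log (Real.log r) + gammaStar)| ≤
      r * |symSup m ε| * (C / Real.log r) :=
    mul_le_mul_of_nonneg_left (hC r hr) (by positivity)
  have h4 := mul_le_mul_of_nonneg_left htail hr0.le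
  have h5 : r * (K * (C₂ / (r * Real.log r))) ≤ K * C₂ * (r / Real.log r) := by
    have e5 : r * (K * (C₂ / (r * Real.log r))) = K * C₂ * (1 / Real.log r) := by field_simp
    rw [e5]
    refine mul_le_mul_of_nonneg_left ?_ (mul_nonneg H.K_nonneg hC₂)
    exact div_le_div_of_nonneg_right (by linarith) hl.le
  calc _ ≤ r * |symSup m ε| * (C / Real.log r) + K * C₂ * (r / Real.log r) := by linarith
    _ = _ := by ring

lemma SymData.isBigO_log_twistedL (H : SymData m χ l K) (W : WeightData s ρ w K' c) {ε : ℝ}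
    (hε : ε = 1 ∨ ε = -1) :
    (fun r : ℝ => Real.log (twistedL s 1 ρ (sym m) ((ε * r : ℝ) : ℂ)).re - mainTerm m ε r)
      =O[atTop] fun r : ℝ => r / Real.log r := by
  have hεabs : |ε| = 1 := by rcases hε with rfl | rfl <;> norm_num
  obtain ⟨A, hA⟩ := (H.localData W).exists_abs_tsum_log_localInt_sub_le hεabs
    (H.exists_logDSup_eq hε)
  obtain ⟨B, hB⟩ := H.exists_abs_sum_logDSup_sub_le hε
  refine IsBigO.of_bound (A + B) ?_
  filter_upwards [eventually_ge_atTop 2] with r hr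
  have hl : 0 < Real.log r := Real.log_pos (by linarith)
  rw [H.twistedL_eq W, Complex.ofReal_re, Real.log_exp, Real.norm_eq_abs, Real.norm_eq_abs,
    abs_of_nonneg (show 0 ≤ r / Real.log r from div_nonneg (by linarith) hl.le), add_mul]
  rw [← sub_add_sub_cancel _ (r * ∑ p ∈ primesLe r, logDSup m ε p) (mainTerm m ε r)]
  exact (abs_add_le _ _).trans (add_le_add (hA r hr) (hB r hr))

lemma SymData.multipliable_and_pos (H : SymData m χ l K) (W : WeightData s ρ w K' c) (z : ℝ) :
    Multipliable (localFactor s 1 ρ (sym m) z) ∧ 0 < (twistedL s 1 ρ (sym m) z).re ∧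
      (twistedL s 1 ρ (sym m) z).im = 0 := by
  refine ⟨(H.hasProd_localFactor W z).multipliable, ?_, ?_⟩
  · rw [H.twistedL_eq W, Complex.ofReal_re]; exact Real.exp_pos _
  · rw [H.twistedL_eq W, Complex.ofReal_im]

end

lemma exists_symData {m : ℕ} (hm : m ∈ ({1, 2, 4} : Set ℕ)) : ∃ χ l K, SymData m χ l K := by
  simp only [Set.mem_insert_iff, Set.mem_singleton_iff] at hm
  rcases hm with rfl | rfl | rfl
  exacts [symData_one, symData_two, symData_four]

end SymPow

theorem mainTheorem6 :
    (∃ C : ℝ, ∀ x : ℝ, 2 ≤ x →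
      |SymPow.primeRecipSum x - (Real.log (Real.log x) + SymPow.gammaStar)| ≤ C / Real.log x) ∧
    ∀ m ∈ ({1, 2, 4} : Set ℕ),
      (∀ ε ∈ ({1, -1} : Set ℝ), Summable (SymPow.symOneTerm m ε)) ∧
      (∀ r : ℝ,
        Multipliable (SymPow.localFactor (1 / 2) 1 SymPow.st (SymPow.sym m) r) ∧
        0 < (SymPow.twistedL (1 / 2) 1 SymPow.st (SymPow.sym m) r).re ∧
        (SymPow.twistedL (1 / 2) 1 SymPow.st (SymPow.sym m) r).im = 0) ∧
      (∀ r : ℝ,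
        Multipliable (SymPow.localFactor 1 1 (SymPow.sym 2) (SymPow.sym m) r) ∧
        0 < (SymPow.twistedL 1 1 (SymPow.sym 2) (SymPow.sym m) r).re ∧
        (SymPow.twistedL 1 1 (SymPow.sym 2) (SymPow.sym m) r).im = 0) ∧
      ∀ ε ∈ ({1, -1} : Set ℝ),
        ((fun r : ℝ =>
            Real.log (SymPow.twistedL (1 / 2) 1 SymPow.st (SymPow.sym m) ((ε * r : ℝ) : ℂ)).re -
              SymPow.mainTerm m ε r) =O[atTop] fun r : ℝ => r / Real.log r) ∧
        ((fun r : ℝ =>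
            Real.log (SymPow.twistedL 1 1 (SymPow.sym 2) (SymPow.sym m) ((ε * r : ℝ) : ℂ)).re -
              SymPow.mainTerm m ε r) =O[atTop] fun r : ℝ => r / Real.log r) := by
  obtain ⟨w₁, K₁, c₁, W₁⟩ := SymPow.weightData_st
  obtain ⟨w₂, K₂, c₂, W₂⟩ := SymPow.weightData_sym_two
  refine ⟨SymPow.exists_abs_primeRecipSum_sub_gammaStar_le, fun m hm => ?_⟩
  obtain ⟨χ, l, K, H⟩ := SymPow.exists_symData hm
  exact ⟨fun ε hε => H.summable_symOneTerm hε, H.multipliable_and_pos W₁, H.multipliable_and_pos W₂,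
    fun ε hε => ⟨H.isBigO_log_twistedL W₁ hε, H.isBigO_log_twistedL W₂ hε⟩⟩
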